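/- **Conventions.** Let $(\mathcal C,\otimes,1)$ be a monoidal category. An object $K$ is *dualizing* if for every $Y$ the functor $\operatorname{Hom}(-\otimes Y,K)$ is representable by some object $DY$ and the induced contravariant functor $D$ is an antiequivalence. A *GV-category* is a monoidal category with a chosen dualizing object $K$. A GV-category is closed: let $X\multimap{?}$ be right adjoint to $X\otimes{?}$, let $[X,{?}]^{r}$ be right adjoint to ${?}\otimes X$, and put $D=[{?},K]^{r}$ and $D'={?}\multimap K$. The unit $d\colon X\to D'DX$ and the counit $\tilde d\colon X\to DD'X$ of the adjunction between $D$ and $D'$ are invertible. The second monoidal structure on $\mathcal C$ is $X\odot Y:=D(D'Y\otimes D'X)$ with unit $K$; its associator and unitors are induced by those of $\otimes$ through $D$ (and $d$, $\tilde d$). A *GV-coalgebra* is a coalgebra in $(\mathcal C,\odot,K)$. Let $(A,\mu,\eta)$ be an algebra in $(\mathcal C,\otimes,1)$. Then $D(A)$ is a GV-coalgebra with comultiplication $D(A)\xrightarrow{D(\mu)}D(A\otimes A)\cong D(D'DA\otimes D'DA)=D(A)\odot D(A)$ and counit $D(A)\xrightarrow{D(\eta)}D(1)\cong K$; and $D'(A)$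 is a GV-coalgebra with comultiplication $D'(A)\xrightarrow{D'(\mu)}(A\otimes A)\multimap K\cong A\multimap(A\multimap K)\cong D'(A)\odot D'(A)$ and counit $D'(A)\xrightarrow{D'(\eta)}D'(1)\cong K$. The multiplication of $A$ induces a left $A$-action on $D'(A)=A\multimap K$ and a right $A$-action on $D(A)=[A,K]^{r}$. A *Frobenius form* on a lax monoidal functor $F\colon\mathcal C\to\mathcal E$ between GV-categories with dualizing objects $K$ and $k$ is a morphism $\upsilon\colon F(K)\to k$ such that, for every $X$, the composites $$F(X\multimap K)\to F(X)\multimap F(K)\xrightarrow{F(X)\multimap\upsilon}F(X)\multimap k,\qquad F([X,K]^{r})\to [F(X),F(K)]^{r}\xrightarrow{[F(X),\upsilon]^{r}}[F(X),k]^{r}$$ are invertible, where the first arrows are the transposes of $F(X)\otimes F(X\multimap K)\to F(X\otimes(X\multimap K))\to F(K)$ and of $F([X,K]^{r})\otimes F(X)\to F([X,K]^{r}\otimes X)\to F(K)$. A *GV-functor* is a lax monoidal functor with a Frobenius form. **Proposition.** Let $\mathcal C$ be a GV-category with dualizing object $K$ that admits equalizers and coequalizers, let $A=(A,\mu,\eta)$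 be an algebra in $(\mathcal C,\otimes,1)$, and let $f\colon D(A)\xrightarrow{\ \simeq\ }D'(A)$ be an isomorphism of GV-coalgebras. Then: 1. the right $A$-action on $D(A)$ and the left $A$-action on $D'(A)$, transported to $D(A)$ along $f$, make $D(A)$ an $A$-bimodule; 2. this bimodule $D(A)\cong D'(A)$ is a dualizing object of the monoidal category $({}_A\mathcal C_A,\otimes_A,A)$ of $A$-bimodules, which is thereby a GV-category (in particular left and right closed); 3. the forgetful functor $U\colon{}_A\mathcal C_A\to\mathcal C$, with the lax monoidal structure given by $\eta\colon1\to A$ and the projections $M\otimes N\to M\otimes_AN$, is a GV-functor, with Frobenius form $U(D(A))=D(A)\xrightarrow{D(\eta)}D(1)\cong K$. -/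

import Mathlib

open CategoryTheory MonoidalCategory Opposite MonoidalOpposite

universe v u v₁ u₁

set_option linter.unusedSectionVars false

namespace GV

lemma opmop_ext {C : Type u} [Category.{v} C] {X Y : (Cᴹᵒᵖ)ᵒᵖ} {g h : X ⟶ Y} (w : g.unop.unmop = h.unop.unmop) : g = h :=
  Quiver.Hom.unop_inj (Quiver.Hom.unmop_inj w)

/-- A monoidal category is right closed if every functor `? ⊗ X` has a (chosen) right adjoint,
the right internal hom `? ⟜ X`. The left internal hom `X ⊸ ?`, right adjoint to `X ⊗ ?`, is
Mathlib's `ihom X`, and left closedness is Mathlib's `MonoidalClosed`. -/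
class RightClosed (C : Type u) [Category.{v} C] [MonoidalCategory C] where
  /-- the functor `? ⟜ X` -/
  rhom (X : C) : C ⥤ C
  /-- the adjunction between `? ⊗ X` and `? ⟜ X` -/
  adj (X : C) : tensorRight X ⊣ rhom X

section RightClosed

variable {C : Type u} [Category.{v} C] [MonoidalCategory C] [RightClosed C]

/-- `rhom X Z = Z ⟜ X`. -/
abbrev rhom (X Z : C) : C := (RightClosed.rhom X).obj Z

/-- The right evaluation `(Z ⟜ X) ⊗ X ⟶ Z`. -/
def rev (X Z : C) : rhom X Z ⊗ X ⟶ Z := (RightClosed.adj X).counit.app Z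

/-- The bijection `Hom(Y ⊗ X, Z) → Hom(Y, Z ⟜ X)`. -/
def rcurry {X Y Z : C} (g : Y ⊗ X ⟶ Z) : Y ⟶ rhom X Z := (RightClosed.adj X).homEquiv Y Z g

lemma rcurry_rev {X Y Z : C} (g : Y ⊗ X ⟶ Z) : rcurry g ▷ X ≫ rev X Z = g :=
  ((RightClosed.adj X).homEquiv_counit (g := rcurry g)).symm.trans
    (((RightClosed.adj X).homEquiv Y Z).symm_apply_apply g)

lemma rhom_ext {X Y Z : C} {g h : Y ⟶ rhom X Z} (w : g ▷ X ≫ rev X Z = h ▷ X ≫ rev X Z) :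
    g = h := by
  apply ((RightClosed.adj X).homEquiv Y Z).symm.injective
  rw [(RightClosed.adj X).homEquiv_counit, (RightClosed.adj X).homEquiv_counit]
  exact w

lemma rhom_map_rev {X Y Z : C} (g : Y ⟶ Z) :
    (RightClosed.rhom X).map g ▷ X ≫ rev X Z = rev X Y ≫ g :=
  (RightClosed.adj X).counit.naturality g

end RightClosed

section LeftClosed

variable {C : Type u} [Category.{v} C] [MonoidalCategory C] [MonoidalClosed C]

lemma curry_ev {X Y Z : C} (g : X ⊗ Y ⟶ Z) :
    X ◁ MonoidalClosed.curry g ≫ (ihom.ev X).app Z = g :=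
  MonoidalClosed.uncurry_curry g

lemma ihom_ext {X Y Z : C} {g h : Y ⟶ (ihom X).obj Z}
    (w : X ◁ g ≫ (ihom.ev X).app Z = X ◁ h ≫ (ihom.ev X).app Z) : g = h :=
  MonoidalClosed.uncurry_injective w

end LeftClosed

section Dual

variable {C : Type u} [Category.{v} C] [MonoidalCategory C]

/-- A duality functor associated to `K`: a contravariant functor `D` together with bijections
`Hom(X ⊗ Y, K) ≃ Hom(X, D Y)`, natural in `X` (so that `D Y` represents `Hom(? ⊗ Y, K)`) and in
`Y` (so that `D` is the functor induced by these representations). -/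
structure DualityFunctor (K : C) where
  /-- the functor -/
  D : Cᵒᵖ ⥤ C
  /-- the representation of `Hom(? ⊗ Y, K)` by `D Y` -/
  homEquiv (X Y : C) : (X ⊗ Y ⟶ K) ≃ (X ⟶ D.obj (op Y))
  homEquiv_naturality_left {X X' : C} (Y : C) (g : X' ⟶ X) (h : X ⊗ Y ⟶ K) :
    homEquiv X' Y (g ▷ Y ≫ h) = g ≫ homEquiv X Y h
  homEquiv_naturality_right (X : C) {Y Y' : C} (g : Y' ⟶ Y) (h : X ⊗ Y ⟶ K) :
    homEquiv X Y' (X ◁ g ≫ h) = homEquiv X Y h ≫ D.map g.op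

/-- `K` is a dualizing object: for every `Y` the functor `Hom(? ⊗ Y, K)` is representable by some
object `D Y`, and the induced contravariant functor `D` is an antiequivalence. A
Grothendieck-Verdier category is a monoidal category with a dualizing object. -/
class IsDualizing (K : C) : Prop where
  exists_dualityFunctor : ∃ d : DualityFunctor K, d.D.IsEquivalence

section
variable [RightClosed C]

/-- The functor `D = (K ⟜ ?)`. -/
def dualR (K : C) : Cᵒᵖ ⥤ C where
  obj X := rhom X.unop K
  map {X Y} g := rcurry (rhom X.unop K ◁ g.unop ≫ rev X.unop K)
  map_id X := rhom_ext (by simp [rcurry_rev])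
  map_comp {X Y Z} g h := rhom_ext (by
    rw [rcurry_rev, comp_whiskerRight, Category.assoc, rcurry_rev, ← whisker_exchange_assoc,
      rcurry_rev]
    simp)

/-- `D X = K ⟜ X`. -/
abbrev DR (K X : C) : C := (dualR K).obj (op X)

/-- The action of `D` on morphisms. -/
abbrev DRmap (K : C) {X Y : C} (g : X ⟶ Y) : DR K Y ⟶ DR K X := (dualR K).map g.op

/-- The evaluation `D X ⊗ X ⟶ K`. -/
def evR (K X : C) : DR K X ⊗ X ⟶ K := rev X K

lemma DRmap_evR (K : C) {X Y : C} (g : X ⟶ Y) :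
    DRmap K g ▷ X ≫ evR K X = DR K Y ◁ g ≫ evR K Y :=
  rcurry_rev _

/-- transposition `Hom(Y ⊗ X, K) → Hom(Y, D X)` -/
def curryR {K X Y : C} (g : Y ⊗ X ⟶ K) : Y ⟶ DR K X := rcurry g

lemma curryR_evR {K X Y : C} (g : Y ⊗ X ⟶ K) : curryR g ▷ X ≫ evR K X = g := rcurry_rev g

lemma DR_ext {K X Y : C} {g h : Y ⟶ DR K X} (w : g ▷ X ≫ evR K X = h ▷ X ≫ evR K X) : g = h :=
  rhom_ext w

lemma dualR_isEquivalence (K : C) [IsDualizing K] : (dualR K).IsEquivalence := by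
  obtain ⟨d, hd⟩ := IsDualizing.exists_dualityFunctor (K := K)
  have e : d.D ≅ dualR K := NatIso.ofComponents
    (fun Y => Yoneda.ext _ _ (fun g => curryR ((d.homEquiv _ _).symm g))
      (fun g => d.homEquiv _ _ (g ▷ Y.unop ≫ evR K Y.unop))
      (fun g => by rw [curryR_evR]; simp)
      (fun g => by rw [Equiv.symm_apply_apply]; exact DR_ext (curryR_evR _))
      (fun g h => by
        apply DR_ext
        rw [curryR_evR, comp_whiskerRight, Category.assoc, curryR_evR]
        apply (d.homEquiv _ _).injective
        rw [Equiv.apply_symm_apply, d.homEquiv_naturality_left, Equiv.apply_symm_apply]))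
    (fun {Y Y'} g => by
      apply DR_ext
      change (d.D.map g ≫ curryR ((d.homEquiv _ _).symm (𝟙 _))) ▷ _ ≫ _ =
        (curryR ((d.homEquiv _ _).symm (𝟙 _)) ≫ DRmap K g.unop) ▷ _ ≫ _
      rw [comp_whiskerRight, comp_whiskerRight, Category.assoc, Category.assoc, curryR_evR,
        DRmap_evR, ← whisker_exchange_assoc, curryR_evR]
      apply (d.homEquiv _ _).injective
      rw [d.homEquiv_naturality_left, d.homEquiv_naturality_right, Equiv.apply_symm_apply,
        Equiv.apply_symm_apply]
      simp)
  exact Functor.isEquivalence_of_iso e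

instance dualR_rightOp_isEquivalence (K : C) [IsDualizing K] :
    (dualR K).rightOp.IsEquivalence := by
  have := dualR_isEquivalence K
  infer_instance

end

section
variable [MonoidalClosed C]

/-- The functor `D' = (? ⊸ K)`. -/
def dualL (K : C) : Cᵒᵖ ⥤ C where
  obj X := (ihom X.unop).obj K
  map g := (MonoidalClosed.pre g.unop).app K
  map_id X := by simp
  map_comp g h := by simp

/-- `D' X = X ⊸ K`. -/
abbrev DL (K X : C) : C := (dualL K).obj (op X)

/-- The action of `D'` on morphisms. -/
abbrev DLmap (K : C) {X Y : C} (g : X ⟶ Y) : DL K Y ⟶ DL K X := (dualL K).map g.op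

lemma DLmap_id (K X : C) : DLmap K (𝟙 X) = 𝟙 (DL K X) := (dualL K).map_id _

lemma DLmap_comp (K : C) {X Y Z : C} (g : X ⟶ Y) (h : Y ⟶ Z) :
    DLmap K (g ≫ h) = DLmap K h ≫ DLmap K g :=
  (dualL K).map_comp h.op g.op

/-- The evaluation `X ⊗ D' X ⟶ K`. -/
def evL (K X : C) : X ⊗ DL K X ⟶ K := (ihom.ev X).app K

lemma DLmap_evL (K : C) {X Y : C} (g : X ⟶ Y) :
    X ◁ DLmap K g ≫ evL K X = g ▷ DL K Y ≫ evL K Y :=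
  MonoidalClosed.id_tensor_pre_app_comp_ev g K

/-- transposition `Hom(X ⊗ Y, K) → Hom(Y, D' X)` -/
def curryL {K X Y : C} (g : X ⊗ Y ⟶ K) : Y ⟶ DL K X := MonoidalClosed.curry g

lemma curryL_evL {K X Y : C} (g : X ⊗ Y ⟶ K) : X ◁ curryL g ≫ evL K X = g := curry_ev g

lemma DL_ext {K X Y : C} {g h : Y ⟶ DL K X} (w : X ◁ g ≫ evL K X = X ◁ h ≫ evL K X) : g = h :=
  ihom_ext w

end

variable [MonoidalClosed C] [RightClosed C]

/-- The unit `d : X ⟶ D' D X`, the transpose of the evaluation `D X ⊗ X ⟶ K`. -/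
def dd (K X : C) : X ⟶ DL K (DR K X) := curryL (evR K X)

/-- The counit `d̃ : X ⟶ D D' X`, the transpose of the evaluation `X ⊗ D' X ⟶ K`. -/
def dd' (K X : C) : X ⟶ DR K (DL K X) := curryR (evL K X)

lemma dd_evL (K X : C) : DR K X ◁ dd K X ≫ evL K (DR K X) = evR K X := curryL_evL _

lemma dd'_evR (K X : C) : dd' K X ▷ DL K X ≫ evR K (DL K X) = evL K X := curryR_evR _

lemma dd_natural (K : C) {X Y : C} (g : X ⟶ Y) :
    g ≫ dd K Y = dd K X ≫ DLmap K (DRmap K g) := by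
  apply DL_ext
  simp only [MonoidalCategory.whiskerLeft_comp, Category.assoc]
  rw [dd_evL, DLmap_evL, whisker_exchange_assoc, dd_evL, DRmap_evR]

lemma dd'_natural (K : C) {X Y : C} (g : X ⟶ Y) :
    g ≫ dd' K Y = dd' K X ≫ DRmap K (DLmap K g) := by
  apply DR_ext
  simp only [comp_whiskerRight, Category.assoc]
  rw [dd'_evR, DRmap_evR, ← whisker_exchange_assoc, dd'_evR, DLmap_evL]

lemma triangleR (K X : C) : dd' K (DR K X) ≫ DRmap K (dd K X) = 𝟙 _ := by
  apply DR_ext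
  rw [comp_whiskerRight, Category.assoc, DRmap_evR, ← whisker_exchange_assoc, dd'_evR, dd_evL]
  simp

lemma triangleL (K X : C) : dd K (DL K X) ≫ DLmap K (dd' K X) = 𝟙 _ := by
  apply DL_ext
  rw [MonoidalCategory.whiskerLeft_comp, Category.assoc, DLmap_evL, whisker_exchange_assoc,
    dd_evL, dd'_evR]
  simp

/-- `D : C ⥤ Cᵒᵖ` is left adjoint to `D' : Cᵒᵖ ⥤ C`, with unit `d` and counit `d̃`. -/
def dualAdj (K : C) : (dualR K).rightOp ⊣ dualL K where
  unit := { app X := dd K X, naturality _ _ g := dd_natural K g }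
  counit :=
    { app X := (dd' K X.unop).op
      naturality _ _ g := Quiver.Hom.unop_inj (dd'_natural K g.unop).symm }
  left_triangle_components X := Quiver.Hom.unop_inj (triangleR K X)
  right_triangle_components X := triangleL K X.unop

instance isIso_dd (K X : C) [IsDualizing K] : IsIso (dd K X) :=
  inferInstanceAs (IsIso ((dualAdj K).unit.app X))

instance isIso_dd' (K X : C) [IsDualizing K] : IsIso (dd' K X) := by
  have := (dualAdj K).isEquivalence_right_of_isEquivalence_left
  have : IsIso ((dualAdj K).counit.app (op X)) := inferInstance
  exact (isIso_op_iff _).1 this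

/-- `d` as an isomorphism. -/
noncomputable def ddIso (K X : C) [IsDualizing K] : X ≅ DL K (DR K X) := asIso (dd K X)

/-- `d̃` as an isomorphism. -/
noncomputable def dd'Iso (K X : C) [IsDualizing K] : X ≅ DR K (DL K X) := asIso (dd' K X)

end Dual

section Unit

variable {C : Type u} [Category.{v} C] [MonoidalCategory C]

/-- The canonical isomorphism `D 1 = K ⟜ 1 ≅ K`. -/
def gammaR [RightClosed C] (K : C) : DR K (𝟙_ C) ≅ K where
  hom := (ρ_ _).inv ≫ evR K (𝟙_ C)
  inv := curryR (ρ_ K).hom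
  hom_inv_id := DR_ext (by
    rw [comp_whiskerRight, Category.assoc, curryR_evR]
    simp)
  inv_hom_id := by
    rw [rightUnitor_inv_naturality_assoc, curryR_evR]
    simp

/-- The canonical isomorphism `D' 1 = 1 ⊸ K ≅ K`. -/
def gammaL [MonoidalClosed C] (K : C) : DL K (𝟙_ C) ≅ K where
  hom := (λ_ _).inv ≫ evL K (𝟙_ C)
  inv := curryL (λ_ K).hom
  hom_inv_id := DL_ext (by
    rw [MonoidalCategory.whiskerLeft_comp, Category.assoc, curryL_evL]
    simp)
  inv_hom_id := by
    rw [leftUnitor_inv_naturality_assoc, curryL_evL]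
    simp

variable [MonoidalClosed C] [RightClosed C]

/-- The canonical isomorphism `1 ≅ D' K`. -/
noncomputable def unitIso (K : C) [IsDualizing K] : 𝟙_ C ≅ DL K K :=
  ddIso K (𝟙_ C) ≪≫ (dualL K).mapIso (gammaR K).symm.op

lemma unitIso_evL (K : C) [IsDualizing K] : K ◁ (unitIso K).hom ≫ evL K K = (ρ_ K).hom := by
  change K ◁ (dd K _ ≫ DLmap K (gammaR K).inv) ≫ _ = _
  rw [MonoidalCategory.whiskerLeft_comp, Category.assoc, DLmap_evL, whisker_exchange_assoc,
    dd_evL]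
  exact curryR_evR _

end Unit

section Par

variable {C : Type u} [Category.{v} C] [MonoidalCategory C] [MonoidalClosed C] [RightClosed C]

/-- The category `C`, regarded as the carrier of the second monoidal structure `(⅋, K)`
determined by a dualizing object `K`. -/
@[nolint unusedArguments]
def Par (_ : C) : Type u := C

instance (K : C) : Category.{v} (Par K) := inferInstanceAs (Category.{v} C)

variable (K : C) [IsDualizing K]

/-- The second monoidal product `X ⅋ Y = D (D' Y ⊗ D' X)`. -/
abbrev parObj (K X Y : C) : C := DR K (DL K Y ⊗ DL K X)

/-- The second monoidal product on morphisms. -/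
def parMap (K : C) {X X' Y Y' : C} (g : X ⟶ X') (h : Y ⟶ Y') : parObj K X Y ⟶ parObj K X' Y' :=
  DRmap K (DLmap K h ⊗ₘ DLmap K g)

/-- The associator of `⅋`: it is `D (α_{D' Z, D' Y, D' X})`, up to the isomorphisms
`d : D' Z ⊗ D' Y ≅ D' (Y ⅋ Z)` and `d : D' Y ⊗ D' X ≅ D' (X ⅋ Y)`. -/
noncomputable def parAssoc (X Y Z : C) :
    parObj K (parObj K X Y) Z ≅ parObj K X (parObj K Y Z) :=
  (dualR K).mapIso
    (whiskerRightIso (ddIso K (DL K Z ⊗ DL K Y)).symm (DL K X) ≪≫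
      α_ (DL K Z) (DL K Y) (DL K X) ≪≫
      whiskerLeftIso (DL K Z) (ddIso K (DL K Y ⊗ DL K X))).op

/-- The left unitor of `⅋`, induced by `D' X ⊗ D' K ≅ D' X ⊗ 1 ≅ D' X` and `D D' X ≅ X`. -/
noncomputable def parLeftUnitor (X : C) : parObj K K X ≅ X :=
  (dualR K).mapIso ((ρ_ (DL K X)).symm ≪≫ whiskerLeftIso (DL K X) (unitIso K)).op ≪≫
    (dd'Iso K X).symm

/-- The right unitor of `⅋`, induced by `D' K ⊗ D' X ≅ 1 ⊗ D' X ≅ D' X` and `D D' X ≅ X`. -/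
noncomputable def parRightUnitor (X : C) : parObj K X K ≅ X :=
  (dualR K).mapIso ((λ_ (DL K X)).symm ≪≫ whiskerRightIso (unitIso K) (DL K X)).op ≪≫
    (dd'Iso K X).symm

/-- The second monoidal structure `(⅋, K)` on `C`. -/
noncomputable instance parStruct : MonoidalCategoryStruct (Par K) where
  tensorObj X Y := parObj (C := C) K X Y
  whiskerLeft X _ _ g := parMap (C := C) K (𝟙 (X : C)) g
  whiskerRight g Z := parMap (C := C) K g (𝟙 (Z : C))
  tensorHom g h := parMap (C := C) K g h
  tensorUnit := K
  associator X Y Z := parAssoc (C := C) K X Y Z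
  leftUnitor X := parLeftUnitor (C := C) K X
  rightUnitor X := parRightUnitor (C := C) K X

/-- The functor `D'`, from `(C, ⅋, K)` to the opposite of `C` with the reversed product. -/
def parFunctor : Par K ⥤ (Cᴹᵒᵖ)ᵒᵖ where
  obj X := op (.mop (DL K X))
  map g := (DLmap K g).mop.op
  map_id X := by
    change ((dualL K).map (𝟙 _)).mop.op = _
    rw [(dualL K).map_id]; rfl
  map_comp g h := by
    change ((dualL K).map (Quiver.Hom.op h ≫ Quiver.Hom.op g)).mop.op = _
    rw [(dualL K).map_comp]; rfl

instance dualL_isEquivalence : (dualL K).IsEquivalence :=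
  (dualAdj K).isEquivalence_right_of_isEquivalence_left

lemma DLmap_injective {X Y : C} {g h : X ⟶ Y} (w : DLmap K g = DLmap K h) : g = h :=
  Quiver.Hom.op_inj ((dualL K).map_injective w)

instance : (parFunctor K).Faithful where
  map_injective {X Y g h} w := by
    exact DLmap_injective (C := C) K (congrArg (fun t => t.unop.unmop) w)

lemma DLmap_DRmap {X Y : C} (g : X ⟶ Y) :
    DLmap K (DRmap K g) = inv (dd K X) ≫ g ≫ dd K Y := by
  rw [IsIso.eq_inv_comp, dd_natural]

lemma DLmap_inv_dd' (X : C) : DLmap K (inv (dd' K X)) = dd K (DL K X) := by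
  have h := triangleL K X
  rw [← cancel_mono (DLmap K (dd' K X)), h, ← DLmap_comp, IsIso.hom_inv_id]
  exact (dualL K).map_id _

lemma DLmap_parMap {X X' Y Y' : C} (g : X ⟶ X') (h : Y ⟶ Y') :
    DLmap K (parMap K g h) =
      (ddIso K (DL K Y' ⊗ DL K X')).inv ≫ (DLmap K h ⊗ₘ DLmap K g) ≫ (ddIso K (DL K Y ⊗ DL K X)).hom := by
  refine (DLmap_DRmap K _).trans ?_
  simp [ddIso]

lemma DLmap_parAssoc (X Y Z : C) :
    DLmap K (parAssoc K X Y Z).hom = ((ddIso K (DL K (parObj K Y Z) ⊗ DL K X)).inv ≫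
      (ddIso K (DL K Z ⊗ DL K Y)).inv ▷ DL K X) ≫ (α_ _ _ _).hom ≫
      DL K Z ◁ (ddIso K (DL K Y ⊗ DL K X)).hom ≫ (ddIso K (DL K Z ⊗ DL K (parObj K X Y))).hom := by
  refine (DLmap_DRmap K _).trans ?_
  simp [ddIso, parObj]

lemma DLmap_parLeftUnitor (X : C) :
    DLmap K (parLeftUnitor K X).hom = (ρ_ (DL K X)).inv ≫ DL K X ◁ (unitIso K).hom ≫
      (ddIso K (DL K X ⊗ DL K K)).hom := by
  refine (DLmap_comp K (DRmap K _) (inv (dd' K X))).trans ?_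
  rw [DLmap_inv_dd', DLmap_DRmap]
  simp [ddIso]

lemma DLmap_parRightUnitor (X : C) :
    DLmap K (parRightUnitor K X).hom = (λ_ (DL K X)).inv ≫ (unitIso K).hom ▷ DL K X ≫
      (ddIso K (DL K K ⊗ DL K X)).hom := by
  refine (DLmap_comp K (DRmap K _) (inv (dd' K X))).trans ?_
  rw [DLmap_inv_dd', DLmap_DRmap]
  simp [ddIso]

/-- The second monoidal structure, transported along `D'` from that of `C`. -/
noncomputable def parData : Monoidal.InducingFunctorData (parFunctor K) where
  μIso X Y := {
    hom := (ddIso (C := C) K (DL (C := C) K Y ⊗ DL (C := C) K X)).inv.mop.op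
    inv := (ddIso (C := C) K (DL (C := C) K Y ⊗ DL (C := C) K X)).hom.mop.op
    hom_inv_id := opmop_ext (ddIso (C := C) K (DL (C := C) K Y ⊗ DL (C := C) K X)).hom_inv_id
    inv_hom_id := opmop_ext (ddIso (C := C) K (DL (C := C) K Y ⊗ DL (C := C) K X)).inv_hom_id }
  εIso := {
    hom := (unitIso K).inv.mop.op
    inv := (unitIso K).hom.mop.op
    hom_inv_id := opmop_ext (unitIso K).hom_inv_id
    inv_hom_id := opmop_ext (unitIso K).inv_hom_id }
  tensorHom_eq g h := opmop_ext <| (DLmap_parMap (C := C) K g h).trans (Category.assoc _ _ _).symm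
  whiskerLeft_eq X Y Y' g := opmop_ext <|
    (DLmap_parMap (C := C) K (𝟙 (X : C)) g).trans (by
      change _ = ((ddIso (C := C) K _).inv ≫ DLmap (C := C) K g ▷ DL (C := C) K X) ≫
        (ddIso (C := C) K _).hom
      rw [Category.assoc, ← tensorHom_id, ← (dualL (C := C) K).map_id]
      rfl)
  whiskerRight_eq g X := opmop_ext <|
    (DLmap_parMap (C := C) K g (𝟙 (X : C))).trans (by
      change _ = ((ddIso (C := C) K _).inv ≫ DL (C := C) K X ◁ DLmap (C := C) K g) ≫
        (ddIso (C := C) K _).hom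
      rw [Category.assoc, ← id_tensorHom, ← (dualL (C := C) K).map_id]
      rfl)
  associator_eq X Y Z := opmop_ext <| (DLmap_parAssoc (C := C) K X Y Z).trans (by
    change _ = ((((ddIso (C := C) K _).inv ≫ ((ddIso (C := C) K _).inv ⊗ₘ 𝟙 (DL (C := C) K X))) ≫
      (α_ (DL (C := C) K Z) (DL (C := C) K Y) (DL (C := C) K X)).hom) ≫
      (𝟙 (DL (C := C) K Z) ⊗ₘ (ddIso (C := C) K _).hom) ≫ (ddIso (C := C) K _).hom)
    rw [tensorHom_id, id_tensorHom]
    exact (Category.assoc _ _ _).symm)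
  leftUnitor_eq X := opmop_ext <| (DLmap_parLeftUnitor (C := C) K X).trans (by
    change _ = (ρ_ (DL (C := C) K X)).inv ≫ (𝟙 (DL (C := C) K X) ⊗ₘ (unitIso (C := C) K).hom) ≫
      (ddIso (C := C) K _).hom
    rw [id_tensorHom])
  rightUnitor_eq X := opmop_ext <| (DLmap_parRightUnitor (C := C) K X).trans (by
    change _ = (λ_ (DL (C := C) K X)).inv ≫ ((unitIso (C := C) K).hom ⊗ₘ 𝟙 (DL (C := C) K X)) ≫
      (ddIso (C := C) K _).hom
    rw [tensorHom_id])

/-- The monoidal category `(C, ⅋, K)`. Its coalgebras are the GV-coalgebras. -/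
noncomputable instance parMonoidal : MonoidalCategory (Par K) := Monoidal.induced (parFunctor K) (parData K)

lemma par_counit_comul (X : C) (δ : X ⟶ parObj K X X) (ε : X ⟶ K)
    (mul_one : DL K X ◁ ((unitIso K).hom ≫ DLmap K ε) ≫
      ((ddIso K (DL K X ⊗ DL K X)).hom ≫ DLmap K δ) = (ρ_ (DL K X)).hom) :
    δ ≫ parMap K ε (𝟙 X) = (parLeftUnitor K X).inv := by
  rw [← cancel_mono (parLeftUnitor K X).hom, Iso.inv_hom_id]
  apply DLmap_injective K
  rw [DLmap_comp, DLmap_comp, DLmap_parLeftUnitor, DLmap_parMap, DLmap_id]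
  simp only [id_tensorHom, Category.assoc, Iso.hom_inv_id_assoc,
    MonoidalCategory.whiskerLeft_comp] at mul_one ⊢
  rw [mul_one, Iso.inv_hom_id]

lemma par_comul_counit (X : C) (δ : X ⟶ parObj K X X) (ε : X ⟶ K)
    (one_mul : ((unitIso K).hom ≫ DLmap K ε) ▷ DL K X ≫
      ((ddIso K (DL K X ⊗ DL K X)).hom ≫ DLmap K δ) = (λ_ (DL K X)).hom) :
    δ ≫ parMap K (𝟙 X) ε = (parRightUnitor K X).inv := by
  rw [← cancel_mono (parRightUnitor K X).hom, Iso.inv_hom_id]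
  apply DLmap_injective K
  rw [DLmap_comp, DLmap_comp, DLmap_parRightUnitor, DLmap_parMap, DLmap_id]
  simp only [tensorHom_id, Category.assoc, Iso.hom_inv_id_assoc, comp_whiskerRight]
    at one_mul ⊢
  rw [one_mul, Iso.inv_hom_id]

lemma par_comul_assoc (X : C) (δ : X ⟶ parObj K X X) (m : DL K X ⊗ DL K X ⟶ DL K X)
    (hm : (ddIso K (DL K X ⊗ DL K X)).hom ≫ DLmap K δ = m)
    (assoc : m ▷ DL K X ≫ m = (α_ _ _ _).hom ≫ DL K X ◁ m ≫ m) :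
    δ ≫ parMap K (𝟙 X) δ = δ ≫ parMap K δ (𝟙 X) ≫ (parAssoc K X X X).hom := by
  have h : DLmap K δ = (ddIso K (DL K X ⊗ DL K X)).inv ≫ m := by
    rw [← hm, Iso.inv_hom_id_assoc]
  apply DLmap_injective K
  rw [DLmap_comp, DLmap_comp, DLmap_comp, DLmap_parMap, DLmap_parMap, DLmap_parAssoc, DLmap_id, h]
  simp only [tensorHom_id, id_tensorHom, Category.assoc, Iso.hom_inv_id_assoc,
    comp_whiskerRight, MonoidalCategory.whiskerLeft_comp, assoc, whiskerLeft_hom_inv_assoc]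

/-- A `⅋`-coalgebra structure on `X` from a `⊗`-algebra structure on `D' X`. -/
@[reducible]
noncomputable def comonOfMon (X : C) (δ : X ⟶ parObj K X X) (ε : X ⟶ K)
    (m : DL K X ⊗ DL K X ⟶ DL K X) (e : 𝟙_ C ⟶ DL K X)
    (hm : (ddIso K (DL K X ⊗ DL K X)).hom ≫ DLmap K δ = m)
    (he : (unitIso K).hom ≫ DLmap K ε = e)
    (one_mul : e ▷ DL K X ≫ m = (λ_ (DL K X)).hom)
    (mul_one : DL K X ◁ e ≫ m = (ρ_ (DL K X)).hom)
    (assoc : m ▷ DL K X ≫ m = (α_ _ _ _).hom ≫ DL K X ◁ m ≫ m) :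
    ComonObj (C := Par K) X where
  counit := ε
  comul := δ
  counit_comul := par_counit_comul K X δ ε (by rw [hm, he, mul_one])
  comul_counit := par_comul_counit K X δ ε (by rw [hm, he, one_mul])
  comul_assoc := par_comul_assoc K X δ m hm assoc

end Par

section Algebra

open MonObj

variable {C : Type u} [Category.{v} C] [MonoidalCategory C]

/-- The internal adjunction isomorphism `(X ⊗ Y) ⊸ Z ⟶ Y ⊸ (X ⊸ Z)`. -/
def beta [MonoidalClosed C] (X Y Z : C) :
    (ihom (X ⊗ Y)).obj Z ⟶ (ihom Y).obj ((ihom X).obj Z) :=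
  MonoidalClosed.curry (MonoidalClosed.curry ((α_ _ _ _).inv ≫ (ihom.ev (X ⊗ Y)).app Z))

/-- The right internal composition `(Z ⟜ Y) ⊗ (Y ⟜ X) ⟶ Z ⟜ X`. -/
def rcomp [RightClosed C] (X Y Z : C) : rhom Y Z ⊗ rhom X Y ⟶ rhom X Z :=
  rcurry ((α_ _ _ _).hom ≫ rhom Y Z ◁ rev X Y ≫ rev Y Z)

variable (K : C) (A : Mon C)

/-- The left `A`-action on `D' A = A ⊸ K` induced by the regular right action of `A` on itself:
the composite `A ⊗ (A ⊸ K) ⟶ (A ⊸ A) ⊗ (A ⊸ K) ⟶ A ⊸ K` of the transpose of the multiplication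
and internal composition. -/
def actL [MonoidalClosed C] : A.X ⊗ DL K A.X ⟶ DL K A.X :=
  MonoidalClosed.curry (μ[A.X]) ▷ DL K A.X ≫ MonoidalClosed.comp A.X A.X K

/-- The right `A`-action on `D A = K ⟜ A` induced by the regular left action of `A` on itself:
the composite `(K ⟜ A) ⊗ A ⟶ (K ⟜ A) ⊗ (A ⟜ A) ⟶ K ⟜ A` of the transpose of the multiplication
and internal composition. -/
def actR [RightClosed C] : DR K A.X ⊗ A.X ⟶ DR K A.X :=
  DR K A.X ◁ rcurry (μ[A.X]) ≫ rcomp A.X A.X K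

section
variable [MonoidalClosed C]

lemma comp_curry_ev {X Y Z W : C} (g : X ⊗ Y ⟶ W) :
    X ◁ (MonoidalClosed.curry g ▷ (ihom W).obj Z ≫ MonoidalClosed.comp X W Z) ≫
      (ihom.ev X).app Z = (α_ _ _ _).inv ≫ g ▷ (ihom W).obj Z ≫ (ihom.ev W).app Z := by
  have h : X ◁ MonoidalClosed.comp X W Z ≫ (ihom.ev X).app Z =
      (α_ _ _ _).inv ≫ (ihom.ev X).app W ▷ (ihom W).obj Z ≫ (ihom.ev W).app Z :=
    curry_ev _
  rw [MonoidalCategory.whiskerLeft_comp, Category.assoc, h,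
    associator_inv_naturality_middle_assoc, ← comp_whiskerRight_assoc, curry_ev]

lemma actL_evL : A.X ◁ actL K A ≫ evL K A.X =
    (α_ _ _ _).inv ≫ μ[A.X] ▷ DL K A.X ≫ evL K A.X :=
  comp_curry_ev _

lemma one_actL : η[A.X] ▷ DL K A.X ≫ actL K A = (λ_ _).hom := by
  apply DL_ext
  rw [MonoidalCategory.whiskerLeft_comp, Category.assoc, actL_evL,
    associator_inv_naturality_middle_assoc, ← comp_whiskerRight_assoc, MonObj.mul_one]
  simp

lemma mul_actL : μ[A.X] ▷ DL K A.X ≫ actL K A =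
    (α_ _ _ _).hom ≫ A.X ◁ actL K A ≫ actL K A := by
  apply DL_ext
  simp only [MonoidalCategory.whiskerLeft_comp, Category.assoc, actL_evL]
  rw [associator_inv_naturality_middle_assoc, ← comp_whiskerRight_assoc,
    associator_inv_naturality_right_assoc, whisker_exchange_assoc, actL_evL,
    MonObj.mul_assoc_flip]
  simp only [comp_whiskerRight, Category.assoc]
  rw [associator_inv_naturality_left_assoc]
  monoidal

end

section
variable [RightClosed C]

lemma rcomp_rcurry_rev {X Y Z W : C} (g : Y ⊗ X ⟶ W) :
    (rhom W Z ◁ rcurry g ≫ rcomp X W Z) ▷ X ≫ rev X Z =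
      (α_ _ _ _).hom ≫ rhom W Z ◁ g ≫ rev W Z := by
  have h : rcomp X W Z ▷ X ≫ rev X Z =
      (α_ _ _ _).hom ≫ rhom W Z ◁ rev X W ≫ rev W Z :=
    rcurry_rev _
  rw [comp_whiskerRight, Category.assoc, h,
    associator_naturality_middle_assoc, ← MonoidalCategory.whiskerLeft_comp_assoc, rcurry_rev]

lemma actR_evR : actR K A ▷ A.X ≫ evR K A.X =
    (α_ _ _ _).hom ≫ DR K A.X ◁ μ[A.X] ≫ evR K A.X :=
  rcomp_rcurry_rev _

lemma actR_one : DR K A.X ◁ η[A.X] ≫ actR K A = (ρ_ _).hom := by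
  apply DR_ext
  rw [comp_whiskerRight, Category.assoc, actR_evR,
    associator_naturality_middle_assoc, ← MonoidalCategory.whiskerLeft_comp_assoc, MonObj.one_mul]
  simp

lemma actR_mul : DR K A.X ◁ μ[A.X] ≫ actR K A =
    (α_ _ _ _).inv ≫ actR K A ▷ A.X ≫ actR K A := by
  apply DR_ext
  simp only [comp_whiskerRight, Category.assoc, actR_evR]
  rw [associator_naturality_middle_assoc, ← MonoidalCategory.whiskerLeft_comp_assoc,
    associator_naturality_left_assoc, ← whisker_exchange_assoc, actR_evR,
    MonObj.mul_assoc]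
  simp only [MonoidalCategory.whiskerLeft_comp, Category.assoc]
  rw [associator_naturality_right_assoc]
  monoidal

end

end Algebra

section Coalgebra

open MonObj

variable {C : Type u} [Category.{v} C] [MonoidalCategory C] [MonoidalClosed C] [RightClosed C]

section
variable (K : C) [IsDualizing K] (A : Mon C)

/-- The comultiplication of `D A`: the composite of `D μ : D A ⟶ D (A ⊗ A)` and
the isomorphism `D (A ⊗ A) ≅ D (D' D A ⊗ D' D A) = D A ⅋ D A` induced by `d : A ≅ D' D A`. -/
noncomputable def comulR : DR K A.X ⟶ parObj K (DR K A.X) (DR K A.X) :=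
  DRmap K μ[A.X] ≫ DRmap K ((ddIso K A.X).inv ⊗ₘ (ddIso K A.X).inv)

/-- The counit of `D A`: the composite `D A ⟶ D 1 ≅ K` of `D η` and the canonical isomorphism.
It is also the form on the lax monoidal functor `Bimod A A ⥤ C`. -/
def counitR (K : C) (A : Mon C) : DR K A.X ⟶ K :=
  DRmap K η[A.X] ≫ (gammaR K).hom

/-- The multiplication of `D' D A` corresponding to the comultiplication of `D A`. -/
noncomputable def mulR :
    DL K (DR K A.X) ⊗ DL K (DR K A.X) ⟶ DL K (DR K A.X) :=
  ((ddIso K A.X).inv ⊗ₘ (ddIso K A.X).inv) ≫ μ[A.X] ≫ (ddIso K A.X).hom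

lemma mulR_eq : (ddIso K (DL K (DR K A.X) ⊗ DL K (DR K A.X))).hom ≫ DLmap K (comulR K A) =
    mulR K A := by
  have h : comulR K A = DRmap K (((ddIso K A.X).inv ⊗ₘ (ddIso K A.X).inv) ≫ μ[A.X]) :=
    ((dualR K).map_comp _ _).symm
  rw [h]
  refine (dd_natural K _).symm.trans ?_
  rw [Category.assoc]
  rfl

lemma unitR_eq : (unitIso K).hom ≫ DLmap K (counitR K A) = η[A.X] ≫ (ddIso K A.X).hom := by
  change (dd K _ ≫ DLmap K (gammaR K).inv) ≫ DLmap K (DRmap K η[A.X] ≫ (gammaR K).hom) = _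
  rw [Category.assoc, ← DLmap_comp, Category.assoc, Iso.hom_inv_id, Category.comp_id]
  exact (dd_natural K _).symm


end

section
variable (K : C) [IsDualizing K] (A : Mon C)

/-- The comonoid `D A` in `(C, ⅋, K)`. -/
noncomputable def dualComonR : Comon (Par K) :=
  letI i : MonObj (DL K (DR K A.X)) := MonObj.ofIso (ddIso K A.X)
  { X := DR (C := C) K A.X
    comon := comonOfMon K (DR K A.X) (comulR K A) (counitR K A) (mulR K A)
      (η[A.X] ≫ (ddIso K A.X).hom) (mulR_eq K A) (unitR_eq K A)
      i.one_mul i.mul_one i.mul_assoc }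

end

section
variable (K : C) (A : Mon C)

/-- The internal composition `(Y ⊸ Z) ⊗ (Z ⊸ K) ⟶ Y ⊸ K`. -/
def compK (Y Z : C) : (ihom Y).obj Z ⊗ DL K Z ⟶ DL K Y := MonoidalClosed.comp Y Z K

/-- The isomorphism `Y ⊸ Z ≅ D' Y ⅋ Z`: the transpose of
`(Y ⊸ Z) ⊗ (D' Z ⊗ D' D' Y) ⟶ D' Y ⊗ D' D' Y ⟶ K`. -/
def ihomToPar (Y Z : C) : (ihom Y).obj Z ⟶ parObj K (DL K Y) Z :=
  curryR ((α_ _ _ _).inv ≫ compK K Y Z ▷ DL K (DL K Y) ≫ evL K (DL K Y))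

/-- The isomorphism `(X ⊗ Y) ⊸ K ≅ Y ⊸ (X ⊸ K)`. -/
def betaK (X Y : C) : DL K (X ⊗ Y) ⟶ (ihom Y).obj (DL K X) := beta X Y K

/-- The comultiplication of `D' A`: the composite
`A ⊸ K ⟶ (A ⊗ A) ⊸ K ≅ A ⊸ (A ⊸ K) ≅ D' A ⅋ D' A` of `D' μ` and the canonical isomorphisms. -/
def comulL : DL K A.X ⟶ parObj K (DL K A.X) (DL K A.X) :=
  DLmap K μ[A.X] ≫ betaK K A.X A.X ≫ ihomToPar K A.X (DL K A.X)

/-- The counit of `D' A`: the composite `D' A ⟶ D' 1 ≅ K` of `D' η` and the canonical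
isomorphism. -/
def counitL : DL K A.X ⟶ K :=
  DLmap K η[A.X] ≫ (gammaL K).hom

/-- The right action of `D' D' A` on `D' A` corresponding to the comultiplication of `D' A`. -/
def bL : DL K A.X ⊗ DL K (DL K A.X) ⟶ DL K A.X :=
  (DLmap K μ[A.X] ≫ betaK K A.X A.X) ▷ DL K (DL K A.X) ≫ compK K A.X (DL K A.X)

/-- The multiplication of `D' D' A` corresponding to the comultiplication of `D' A`. -/
def mulL : DL K (DL K A.X) ⊗ DL K (DL K A.X) ⟶ DL K (DL K A.X) :=
  dd K _ ≫ DLmap K (comulL K A)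

lemma ihomToPar_evR {X Y Z : C} (g : X ⟶ (ihom Y).obj Z) :
    (g ≫ ihomToPar K Y Z) ▷ _ ≫ evR K _ = (α_ _ _ _).inv ≫
      (g ▷ DL K Z ≫ compK K Y Z) ▷ DL K (DL K Y) ≫ evL K (DL K Y) := by
  rw [comp_whiskerRight, Category.assoc]
  refine (congrArg _ (curryR_evR _)).trans ?_
  rw [associator_inv_naturality_left_assoc, comp_whiskerRight, Category.assoc]

lemma comulL_evR : comulL K A ▷ _ ≫ evR K _ =
    (α_ _ _ _).inv ≫ bL K A ▷ _ ≫ evL K (DL K A.X) := by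
  rw [comulL, ← Category.assoc]
  exact ihomToPar_evR K _

lemma mulL_evL : DL K A.X ◁ mulL K A ≫ evL K (DL K A.X) =
    (α_ _ _ _).inv ≫ bL K A ▷ _ ≫ evL K (DL K A.X) := by
  rw [mulL, MonoidalCategory.whiskerLeft_comp, Category.assoc, DLmap_evL, whisker_exchange_assoc,
    dd_evL, comulL_evR]

lemma betaK_ev {X Y : C} : X ◁ (Y ◁ betaK K X Y ≫ (ihom.ev Y).app (DL K X)) ≫ evL K X =
    (α_ _ _ _).inv ≫ evL K (X ⊗ Y) :=
  (congrArg (fun t => X ◁ t ≫ evL K X) (curry_ev _)).trans (curry_ev _)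

lemma comul0_eq :
    DLmap K μ[A.X] ≫ betaK K A.X A.X = MonoidalClosed.curry (actL K A) := by
  apply ihom_ext
  rw [curry_ev, MonoidalCategory.whiskerLeft_comp, Category.assoc]
  apply DL_ext
  rw [actL_evL, MonoidalCategory.whiskerLeft_comp, Category.assoc, betaK_ev,
    associator_inv_naturality_right_assoc, DLmap_evL]

lemma bL_evL : A.X ◁ bL K A ≫ evL K A.X =
    (α_ _ _ _).inv ≫ actL K A ▷ _ ≫ evL K (DL K A.X) := by
  rw [bL, comul0_eq]
  exact comp_curry_ev (actL K A)

lemma bL_actL : A.X ◁ bL K A ≫ actL K A = (α_ _ _ _).inv ≫ actL K A ▷ _ ≫ bL K A := by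
  apply DL_ext
  simp only [MonoidalCategory.whiskerLeft_comp, Category.assoc]
  rw [actL_evL, bL_evL, associator_inv_naturality_right_assoc, whisker_exchange_assoc, bL_evL,
    associator_inv_naturality_middle_assoc, ← comp_whiskerRight_assoc (A.X ◁ actL K A),
    associator_inv_naturality_left_assoc, ← comp_whiskerRight_assoc, mul_actL]
  simp only [comp_whiskerRight, Category.assoc]
  monoidal

lemma bL_bL : bL K A ▷ _ ≫ bL K A = (α_ _ _ _).hom ≫ _ ◁ mulL K A ≫ bL K A := by
  apply DL_ext
  simp only [MonoidalCategory.whiskerLeft_comp, Category.assoc]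
  rw [bL_evL, associator_inv_naturality_middle_assoc, ← comp_whiskerRight_assoc, bL_actL,
    associator_inv_naturality_right_assoc, whisker_exchange_assoc, mulL_evL,
    associator_inv_naturality_left_assoc]
  simp only [comp_whiskerRight, Category.assoc]
  monoidal

lemma mulL_assoc : mulL K A ▷ _ ≫ mulL K A = (α_ _ _ _).hom ≫ _ ◁ mulL K A ≫ mulL K A := by
  apply DL_ext
  simp only [MonoidalCategory.whiskerLeft_comp, Category.assoc]
  rw [mulL_evL, associator_inv_naturality_middle_assoc, ← comp_whiskerRight_assoc,
    associator_inv_naturality_right_assoc, whisker_exchange_assoc, mulL_evL,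
    associator_inv_naturality_left_assoc, ← comp_whiskerRight_assoc, bL_bL]
  simp only [comp_whiskerRight, Category.assoc]
  monoidal

lemma counitL_eq : counitL K A = (λ_ _).inv ≫ η[A.X] ▷ _ ≫ evL K A.X := by
  rw [← DLmap_evL, ← leftUnitor_inv_naturality_assoc]
  rfl

section
variable [IsDualizing K]

/-- The unit of `D' D' A` corresponding to the counit of `D' A`. -/
noncomputable def oneL : 𝟙_ C ⟶ DL K (DL K A.X) :=
  (unitIso K).hom ≫ DLmap K (counitL K A)

lemma oneL_evL : DL K A.X ◁ oneL K A ≫ evL K (DL K A.X) = (ρ_ _).hom ≫ counitL K A := by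
  rw [oneL, MonoidalCategory.whiskerLeft_comp, Category.assoc, DLmap_evL, whisker_exchange_assoc,
    unitIso_evL, rightUnitor_naturality]

lemma oneL_bL : DL K A.X ◁ oneL K A ≫ bL K A = (ρ_ _).hom := by
  apply DL_ext
  simp only [MonoidalCategory.whiskerLeft_comp, Category.assoc]
  rw [bL_evL, associator_inv_naturality_right_assoc, whisker_exchange_assoc, oneL_evL,
    rightUnitor_naturality_assoc, counitL_eq, leftUnitor_inv_naturality_assoc,
    whisker_exchange_assoc, actL_evL, associator_inv_naturality_left_assoc,
    ← comp_whiskerRight_assoc, MonObj.one_mul]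
  monoidal

lemma oneL_mulL : oneL K A ▷ _ ≫ mulL K A = (λ_ _).hom := by
  apply DL_ext
  simp only [MonoidalCategory.whiskerLeft_comp, Category.assoc]
  rw [mulL_evL, associator_inv_naturality_middle_assoc, ← comp_whiskerRight_assoc, oneL_bL]
  monoidal

lemma mulL_oneL : _ ◁ oneL K A ≫ mulL K A = (ρ_ _).hom := by
  apply DL_ext
  simp only [MonoidalCategory.whiskerLeft_comp, Category.assoc]
  rw [mulL_evL, associator_inv_naturality_right_assoc, whisker_exchange_assoc, oneL_evL,
    rightUnitor_naturality_assoc, counitL_eq, leftUnitor_inv_naturality_assoc,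
    whisker_exchange_assoc, bL_evL, associator_inv_naturality_left_assoc,
    ← comp_whiskerRight_assoc, one_actL]
  monoidal

/-- The comonoid `D' A` in `(C, ⅋, K)`. -/
noncomputable def dualComonL : Comon (Par K) where
  X := DL (C := C) K A.X
  comon := comonOfMon K (DL K A.X) (comulL K A) (counitL K A) (mulL K A) (oneL K A) rfl rfl
    (oneL_mulL K A) (mulL_oneL K A) (mulL_assoc K A)

end
end
end Coalgebra

section DualBimod

open MonObj

variable {C : Type u} [Category.{v} C] [MonoidalCategory C] [MonoidalClosed C] [RightClosed C]
variable (K : C) [IsDualizing K] (A : Mon C)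

lemma comulR_parMap {X : C} (φ : DR K A.X ⟶ X) :
    comulR K A ≫ parMap K φ φ =
      DRmap K (((DLmap K φ ≫ (ddIso K A.X).inv) ⊗ₘ (DLmap K φ ≫ (ddIso K A.X).inv)) ≫
        μ[A.X]) := by
  rw [← MonoidalCategory.tensorHom_comp_tensorHom, Category.assoc]
  refine Eq.trans ?_ ((dualR K).map_comp _ _).symm
  refine Eq.trans ?_ (congrArg (· ≫ _) ((dualR K).map_comp _ _).symm)
  rfl

lemma transport_evR {X : C} (φ : DR K A.X ⟶ X) :
    DR K A.X ◁ (DLmap K φ ≫ (ddIso K A.X).inv) ≫ evR K A.X = φ ▷ DL K X ≫ evL K X := by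
  rw [← dd_evL, ← DLmap_evL, ← MonoidalCategory.whiskerLeft_comp_assoc, Category.assoc]
  exact congrArg (fun t => DR K A.X ◁ t ≫ evL K _)
    ((congrArg (DLmap K φ ≫ ·) (ddIso K A.X).inv_hom_id).trans (Category.comp_id _))

lemma evL_ext {X Y : C} {g h : X ⟶ Y} (w : g ▷ _ ≫ evL K Y = h ▷ _ ≫ evL K Y) : g = h := by
  rw [← cancel_mono (dd' K Y)]
  apply DR_ext
  rw [comp_whiskerRight, comp_whiskerRight, Category.assoc, Category.assoc, dd'_evR, w]

variable {K A}

lemma key₀ (φ : DR K A.X ⟶ DL K A.X) (h : φ ≫ comulL K A = comulR K A ≫ parMap K φ φ) :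
    φ ▷ _ ≫ bL K A = DR K A.X ◁ (DLmap K φ ≫ (ddIso K A.X).inv) ≫ actR K A ≫ φ := by
  apply evL_ext K
  rw [comulR_parMap] at h
  have h' := congrArg (fun t => (α_ _ _ _).hom ≫ t ▷ _ ≫ evR K _) h
  rw [DRmap_evR, comp_whiskerRight, Category.assoc, comulL_evR,
    associator_inv_naturality_left_assoc, Iso.hom_inv_id_assoc] at h'
  rw [comp_whiskerRight, Category.assoc, h', comp_whiskerRight, comp_whiskerRight, Category.assoc,
    Category.assoc, ← transport_evR]
  generalize DLmap K φ ≫ (ddIso K A.X).inv = g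
  rw [← whisker_exchange_assoc, actR_evR, MonoidalCategory.tensorHom_def]
  simp

lemma key (φ : DR K A.X ≅ DL K A.X)
    (h : φ.hom ≫ comulL K A = comulR K A ≫ parMap K φ.hom φ.hom) :
    (A.X ◁ φ.hom ≫ actL K A ≫ φ.inv) ▷ A.X ≫ evR K A.X =
      (α_ _ _ _).hom ≫ A.X ◁ (actR K A ≫ φ.hom) ≫ evL K A.X := by
  have h₁ := key₀ φ.hom h
  have h₂ := transport_evR K A φ.hom
  have : IsIso (DLmap K φ.hom ≫ (ddIso K A.X).inv) := inferInstance
  generalize DLmap K φ.hom ≫ (ddIso K A.X).inv = g at h₁ h₂ this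
  rw [← cancel_epi ((A.X ⊗ DR K A.X) ◁ g), whisker_exchange_assoc, h₂,
    ← comp_whiskerRight_assoc, Category.assoc, Category.assoc, Iso.inv_hom_id, Category.comp_id,
    associator_naturality_right_assoc, ← MonoidalCategory.whiskerLeft_comp_assoc, ← h₁,
    MonoidalCategory.whiskerLeft_comp, Category.assoc, bL_evL,
    associator_inv_naturality_middle_assoc, Iso.hom_inv_id_assoc, comp_whiskerRight,
    Category.assoc]

/-- The left action on `D A` obtained from the left action on `D' A` along `φ : D A ≅ D' A`. -/
def actLR (φ : DR K A.X ≅ DL K A.X) : A.X ⊗ DR K A.X ⟶ DR K A.X :=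
  A.X ◁ φ.hom ≫ actL K A ≫ φ.inv

lemma one_actLR (φ : DR K A.X ≅ DL K A.X) : η[A.X] ▷ _ ≫ actLR φ = (λ_ _).hom := by
  rw [actLR, ← whisker_exchange_assoc, ← Category.assoc (η[A.X] ▷ _), one_actL,
    leftUnitor_naturality_assoc, Iso.hom_inv_id, Category.comp_id]

lemma mul_actLR (φ : DR K A.X ≅ DL K A.X) :
    μ[A.X] ▷ _ ≫ actLR φ = (α_ _ _ _).hom ≫ A.X ◁ actLR φ ≫ actLR φ := by
  rw [actLR, ← whisker_exchange_assoc, ← Category.assoc (μ[A.X] ▷ _), mul_actL]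
  simp

lemma middle_actLR (φ : DR K A.X ≅ DL K A.X)
    (h : φ.hom ≫ comulL K A = comulR K A ≫ parMap K φ.hom φ.hom) :
    actLR φ ▷ A.X ≫ actR K A = (α_ _ _ _).hom ≫ A.X ◁ actR K A ≫ actLR φ := by
  have hk : actLR φ ▷ A.X ≫ evR K A.X =
      (α_ _ _ _).hom ≫ A.X ◁ (actR K A ≫ φ.hom) ≫ evL K A.X := key φ h
  apply DR_ext
  simp only [comp_whiskerRight, Category.assoc]
  rw [actR_evR, associator_naturality_left_assoc, ← whisker_exchange_assoc, hk,
    associator_naturality_right_assoc, ← MonoidalCategory.whiskerLeft_comp_assoc,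
    ← Category.assoc (_ ◁ μ[A.X]), actR_mul, ← comp_whiskerRight_assoc]
  simp only [comp_whiskerRight, Category.assoc]
  rw [associator_naturality_middle_assoc, ← MonoidalCategory.whiskerLeft_comp_assoc]
  simp

end DualBimod

section DualBimod

variable {C : Type u} [Category.{v} C] [MonoidalCategory C] [MonoidalClosed C] [RightClosed C]
variable {K : C} [IsDualizing K] {A : Mon C}

/-- The isomorphism in `C` underlying an isomorphism `D A ≅ D' A` of comonoids in `(C, ⅋, K)`. -/
def underlyingIso (f : dualComonR K A ≅ dualComonL K A) : DR K A.X ≅ DL K A.X where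
  hom := f.hom.hom
  inv := f.inv.hom
  hom_inv_id := congrArg Comon.Hom.hom f.hom_inv_id
  inv_hom_id := congrArg Comon.Hom.hom f.inv_hom_id

lemma underlyingIso_comul (f : dualComonR K A ≅ dualComonL K A) :
    (underlyingIso f).hom ≫ comulL K A =
      comulR K A ≫ parMap K (underlyingIso f).hom (underlyingIso f).hom :=
  IsComonHom.hom_comul f.hom.hom

/-- The `A`-bimodule `D A`: its right action is that of `D A = K ⟜ A`, and its left action is that
of `D' A = A ⊸ K`, transported along `f : D A ≅ D' A`. -/
def dualBimod (f : dualComonR K A ≅ dualComonL K A) : Bimod A A where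
  X := DR K A.X
  actLeft := actLR (underlyingIso f)
  one_actLeft := one_actLR _
  left_assoc := mul_actLR _
  actRight := actR K A
  actRight_one := actR_one K A
  right_assoc := actR_mul K A
  middle_assoc := middle_actLR _ (underlyingIso_comul f)

end DualBimod

section ClosedOfDualizing

variable {C : Type u} [Category.{v} C] [MonoidalCategory C]

/-- A monoidal category with a dualizing object is right closed. -/
lemma IsDualizing.nonempty_rightClosed (K : C) [IsDualizing K] : Nonempty (RightClosed C) := by
  obtain ⟨d, hd⟩ := IsDualizing.exists_dualityFunctor (K := K)
  let P (Y : C) : C := (d.D.objPreimage Y).unop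
  let i (Y : C) : d.D.obj (op (P Y)) ≅ Y := d.D.objObjPreimageIso Y
  let e (X Z Y : C) : (Z ⊗ X ⟶ Y) ≃ (Z ⟶ d.D.obj (op (X ⊗ P Y))) :=
    ((i Y).homToEquiv.symm.trans (d.homEquiv (Z ⊗ X) (P Y)).symm).trans
      ((α_ Z X (P Y)).homFromEquiv.trans (d.homEquiv Z (X ⊗ P Y)))
  have he (X Z' Z Y : C) (g : Z' ⟶ Z) (h : Z ⊗ X ⟶ Y) :
      e X Z' Y ((tensorRight X).map g ≫ h) = g ≫ e X Z Y h := by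
    refine Eq.trans (congrArg (d.homEquiv _ _) ?_) (d.homEquiv_naturality_left _ g _)
    change (α_ _ _ _).inv ≫ (d.homEquiv _ _).symm ((g ▷ X ≫ h) ≫ (i Y).inv) =
      g ▷ _ ≫ (α_ _ _ _).inv ≫ (d.homEquiv _ _).symm (h ≫ (i Y).inv)
    rw [associator_inv_naturality_left_assoc]
    refine congrArg _ ?_
    apply (d.homEquiv _ _).injective
    rw [Equiv.apply_symm_apply, d.homEquiv_naturality_left, Equiv.apply_symm_apply, Category.assoc]
  exact ⟨{ rhom X := Adjunction.rightAdjointOfEquiv (F := tensorRight X) (e X) (he X)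
           adj X := Adjunction.adjunctionOfEquivRight (F := tensorRight X) (e X) (he X) }⟩

/-- A monoidal category with a dualizing object is left closed. -/
lemma IsDualizing.nonempty_monoidalClosed (K : C) [IsDualizing K] :
    Nonempty (MonoidalClosed C) := by
  obtain ⟨d, hd⟩ := IsDualizing.exists_dualityFunctor (K := K)
  let P (Y : C) : C := (d.D.objPreimage Y).unop
  let i (Y : C) : d.D.obj (op (P Y)) ≅ Y := d.D.objObjPreimageIso Y
  let F := Functor.FullyFaithful.ofFullyFaithful d.D
  let c (X Z : C) : (X ⊗ Z ⟶ K) ≃ (Z ⟶ P X) :=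
    (d.homEquiv X Z).trans ((i X).symm.homFromEquiv.trans
      (F.homEquiv.symm.trans (opEquiv (op (P X)) (op Z))))
  have hc (X Z' Z : C) (g : Z' ⟶ Z) (h : X ⊗ Z ⟶ K) : c X Z' (X ◁ g ≫ h) = g ≫ c X Z h := by
    apply Quiver.Hom.op_inj
    apply d.D.map_injective
    change d.D.map (F.preimage ((i X).hom ≫ d.homEquiv X Z' (X ◁ g ≫ h))) =
      d.D.map (F.preimage ((i X).hom ≫ d.homEquiv X Z h) ≫ g.op)
    rw [d.D.map_comp, F.map_preimage, F.map_preimage, d.homEquiv_naturality_right,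
      Category.assoc]
  let j (Y : C) : Y ≅ P (d.D.obj (op Y)) := (d.D.preimageIso (i (d.D.obj (op Y)))).unop
  let e (X Z Y : C) : (X ⊗ Z ⟶ Y) ≃ (Z ⟶ P (d.D.obj (op Y) ⊗ X)) :=
    ((j Y).homToEquiv.trans (c _ (X ⊗ Z)).symm).trans
      ((α_ _ X Z).symm.homFromEquiv.trans (c (d.D.obj (op Y) ⊗ X) Z))
  have he (X Z' Z Y : C) (g : Z' ⟶ Z) (h : X ⊗ Z ⟶ Y) :
      e X Z' Y ((tensorLeft X).map g ≫ h) = g ≫ e X Z Y h := by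
    refine Eq.trans (congrArg (c _ _) ?_) (hc _ _ _ g _)
    change (α_ _ _ _).hom ≫ (c _ _).symm ((X ◁ g ≫ h) ≫ (j Y).hom) =
      _ ◁ g ≫ (α_ _ _ _).hom ≫ (c _ _).symm (h ≫ (j Y).hom)
    rw [associator_naturality_right_assoc]
    refine congrArg _ ?_
    apply (c _ _).injective
    rw [Equiv.apply_symm_apply, hc, Equiv.apply_symm_apply, Category.assoc]
  exact ⟨{ closed X :=
    { rightAdj := Adjunction.rightAdjointOfEquiv (F := tensorLeft X) (e X) (he X)
      adj := Adjunction.adjunctionOfEquivRight (F := tensorLeft X) (e X) (he X) } }⟩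

end ClosedOfDualizing

section BimoduleCategory

open Limits

variable {C : Type u} [Category.{v} C] [MonoidalCategory C]

instance preservesColimits_tensorLeft [MonoidalClosed C] (X : C) :
    PreservesColimitsOfSize.{0, 0} (tensorLeft X) :=
  (ihom.adjunction X).leftAdjoint_preservesColimits

instance preservesColimits_tensorRight [RightClosed C] (X : C) :
    PreservesColimitsOfSize.{0, 0} (tensorRight X) :=
  (RightClosed.adj X).leftAdjoint_preservesColimits

variable [MonoidalClosed C] [RightClosed C] [HasCoequalizers C] (A : Mon C)

/-- The relative tensor product `M ⊗_A N` of `A`-bimodules, with unit `A`. -/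
noncomputable instance bimodStruct : MonoidalCategoryStruct (Bimod A A) where
  tensorObj M N := M.tensorBimod N
  whiskerLeft L _ _ f := Bimod.whiskerLeft L f
  whiskerRight f N := Bimod.whiskerRight f N
  tensorUnit := Bimod.regular A
  associator := Bimod.associatorBimod
  leftUnitor := Bimod.leftUnitorBimod
  rightUnitor := Bimod.rightUnitorBimod
  tensorHom f g := Bimod.whiskerRight f _ ≫ Bimod.whiskerLeft _ g

lemma bimod_associator_naturality {X₁ X₂ X₃ Y₁ Y₂ Y₃ : Bimod A A} (f₁ : X₁ ⟶ Y₁) (f₂ : X₂ ⟶ Y₂)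
    (f₃ : X₃ ⟶ Y₃) :
    Bimod.whiskerRight (Bimod.whiskerRight f₁ _ ≫ Bimod.whiskerLeft _ f₂) _ ≫
      Bimod.whiskerLeft _ f₃ ≫ (Bimod.associatorBimod Y₁ Y₂ Y₃).hom =
    (Bimod.associatorBimod X₁ X₂ X₃).hom ≫ Bimod.whiskerRight f₁ _ ≫
      Bimod.whiskerLeft _ (Bimod.whiskerRight f₂ _ ≫ Bimod.whiskerLeft _ f₃) := by
  rw [Bimod.comp_whiskerLeft_bimod, Bimod.comp_whiskerRight_bimod, Bimod.whisker_assoc_bimod,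
    Bimod.whiskerRight_comp_bimod, Bimod.whiskerLeft_comp_bimod]
  simp

/-- The monoidal category of `A`-bimodules. -/
noncomputable instance bimodMonoidal : MonoidalCategory (Bimod A A) where
  tensorHom_def _ _ := rfl
  id_tensorHom_id X Y := by
    change Bimod.whiskerRight (𝟙 X) Y ≫ Bimod.whiskerLeft X (𝟙 Y) = _
    rw [Bimod.whiskerLeft_id_bimod, Bimod.id_whiskerRight_bimod, Category.id_comp]
    rfl
  tensorHom_comp_tensorHom f₁ f₂ g₁ g₂ := by
    change (Bimod.whiskerRight f₁ _ ≫ Bimod.whiskerLeft _ f₂) ≫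
      Bimod.whiskerRight g₁ _ ≫ Bimod.whiskerLeft _ g₂ =
      Bimod.whiskerRight (f₁ ≫ g₁) _ ≫ Bimod.whiskerLeft _ (f₂ ≫ g₂)
    rw [Category.assoc, ← Category.assoc (Bimod.whiskerLeft _ _), Bimod.whisker_exchange_bimod,
      Bimod.whiskerLeft_comp_bimod, Bimod.comp_whiskerRight_bimod]
    simp only [Category.assoc]
  whiskerLeft_id _ _ := Bimod.whiskerLeft_id_bimod
  id_whiskerRight _ _ := Bimod.id_whiskerRight_bimod
  associator_naturality f₁ f₂ f₃ :=
    (Category.assoc _ _ _).trans (bimod_associator_naturality A f₁ f₂ f₃)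
  leftUnitor_naturality f := by
    change Bimod.whiskerLeft (Bimod.regular A) f ≫ (Bimod.leftUnitorBimod _).hom =
      (Bimod.leftUnitorBimod _).hom ≫ f
    rw [Bimod.id_whiskerLeft_bimod]
    simp
  rightUnitor_naturality f := by
    change Bimod.whiskerRight f (Bimod.regular A) ≫ (Bimod.rightUnitorBimod _).hom =
      (Bimod.rightUnitorBimod _).hom ≫ f
    rw [Bimod.whiskerRight_id_bimod]
    simp
  pentagon _ _ _ _ := Bimod.pentagon_bimod _ _ _ _
  triangle _ _ := Bimod.triangle_bimod _ _

/-- The forgetful functor from `A`-bimodules is lax monoidal, with `1 ⟶ A` the unit of `A` and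
`M ⊗ N ⟶ M ⊗_A N` the projection to the coequalizer. -/
noncomputable instance forgetLaxMonoidal : (Bimod.forget A (B := A)).LaxMonoidal where
  ε := MonObj.one (X := A.X)
  μ M N := coequalizer.π (M.actRight ▷ N.X) ((α_ _ _ _).hom ≫ M.X ◁ N.actLeft)
  μ_natural_left {X Y} f X' := by
    symm
    exact ι_colimMap _ _
  μ_natural_right X' f := by
    symm
    exact ι_colimMap _ _
  associativity X Y Z := by
    change coequalizer.π _ _ ▷ Z.X ≫ coequalizer.π _ _ ≫ Bimod.AssociatorBimod.hom X Y Z =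
      (α_ X.X Y.X Z.X).hom ≫ X.X ◁ coequalizer.π _ _ ≫ coequalizer.π _ _
    refine (congrArg (_ ≫ ·) (coequalizer.π_desc _ _)).trans ?_
    exact π_tensor_id_preserves_coequalizer_inv_desc _ _ _ _
  left_unitality X := by
    change (λ_ X.X).hom = MonObj.one (X := A.X) ▷ X.X ≫ coequalizer.π _ _ ≫ Bimod.LeftUnitorBimod.hom X
    refine Eq.trans ?_ (congrArg (_ ≫ ·) (coequalizer.π_desc _ _).symm)
    exact X.one_actLeft.symm
  right_unitality X := by
    change (ρ_ X.X).hom = X.X ◁ MonObj.one (X := A.X) ≫ coequalizer.π _ _ ≫ Bimod.RightUnitorBimod.hom X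
    refine Eq.trans ?_ (congrArg (_ ≫ ·) (coequalizer.π_desc _ _).symm)
    exact X.actRight_one.symm

end BimoduleCategory

section FrobeniusForm

variable {C : Type u} [Category.{v} C] [MonoidalCategory C]
variable {E : Type u₁} [Category.{v₁} E] [MonoidalCategory E]
variable (F : C ⥤ E) [F.LaxMonoidal] {K : C} {K' : E}

/-- The left comparator `F (X ⊸ Y) ⟶ F X ⊸ F Y` of a lax monoidal functor. -/
def tauL [MonoidalClosed C] [MonoidalClosed E] (X Y : C) :
    F.obj ((ihom X).obj Y) ⟶ (ihom (F.obj X)).obj (F.obj Y) :=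
  MonoidalClosed.curry (Functor.LaxMonoidal.μ F X ((ihom X).obj Y) ≫ F.map ((ihom.ev X).app Y))

/-- The right comparator `F (Y ⟜ X) ⟶ F Y ⟜ F X` of a lax monoidal functor. -/
def tauR [RightClosed C] [RightClosed E] (X Y : C) :
    F.obj (rhom X Y) ⟶ rhom (F.obj X) (F.obj Y) :=
  rcurry (Functor.LaxMonoidal.μ F (rhom X Y) X ≫ F.map (rev X Y))

/-- The left duality transformation `F (D' X) ⟶ F X ⊸ F K ⟶ D' (F X)` of a lax monoidal functor
with a form `υ : F K ⟶ K'`. -/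
def xiL [MonoidalClosed C] [MonoidalClosed E] (υ : F.obj K ⟶ K') (X : C) :
    F.obj (DL K X) ⟶ DL K' (F.obj X) :=
  tauL F X K ≫ (ihom (F.obj X)).map υ

/-- The right duality transformation `F (D X) ⟶ F K ⟜ F X ⟶ D (F X)` of a lax monoidal functor
with a form `υ : F K ⟶ K'`. -/
def xiR [RightClosed C] [RightClosed E] (υ : F.obj K ⟶ K') (X : C) :
    F.obj (DR K X) ⟶ DR K' (F.obj X) :=
  tauR F X K ≫ (RightClosed.rhom (F.obj X)).map υ

/-- A form `υ : F K ⟶ K'` on a lax monoidal functor is a Frobenius form if both duality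
transformations are invertible. A GV-functor is a lax monoidal functor with a Frobenius form. -/
structure IsFrobeniusForm [MonoidalClosed C] [MonoidalClosed E] [RightClosed C] [RightClosed E]
    (υ : F.obj K ⟶ K') : Prop where
  isIso_xiL : ∀ X : C, IsIso (xiL F υ X)
  isIso_xiR : ∀ X : C, IsIso (xiR F υ X)

end FrobeniusForm

end GV

namespace GV

/-! ### The two evaluation pairings between `A` and `D A` -/

section TwistedEvaluation

open MonObj

variable {C : Type u} [Category.{v} C] [MonoidalCategory C] [MonoidalClosed C] [RightClosed C]
variable {K : C} [IsDualizing K] {A : Mon C}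

/-! Read generalized elements φ of `D A` as functionals on `A`. Then (φa)(b) = φ(ab), `counitR` is
evaluation at 1, and `f` supplies a second pairing tw(a, φ) = `twistedEv`, the evaluation of `D' A`
at f(φ). The left action satisfies tw(b, aφ) = tw(ba, φ). Two facts link the pairings:
comultiplicativity of `f` gives (aφ)(b) = tw(a, φb) (`actLR_evR`), and counitality gives tw(1, φ) =
φ(1) (`one_twistedEv`). The rest follows from these facts and the nondegeneracy of the pairings.

For a bimodule N, every functional φ on N refines to a pairing into `D A`, pair(φ, n)(a) = φ(na)
(`pairR`), from which `counitR` recovers φ(n). Put (φa)(n) = φ(an) and (aφ)(n) = tw(a, pair(φ, n)).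
Then `D N` is a bimodule and the pairing is balanced and bilinear. A right linear map into `D A` is
determined by its composite with `counitR`, because h(m, n)(a) is the counit of h(m, na).
Transposition therefore gives Hom(M ⊗_A N, D A) ≃ Hom(M, D N), that is, `curryBimodEquiv`.

The induced functor is an antiequivalence because the dual in C is one. Linearity passes back from D
g to g by nondegeneracy (`exists_dualBimodRMap_eq`). For essential surjectivity, D'P carries a
mirrored bimodule structure for which d̃ : P ≅ D D'P is bilinear (`bimodBidual`).

Finally, D N and D'P are the right and left internal homs into `D A`, and composing their
evaluations with `counitR` gives the evaluations of C. Hence the duality transformations of the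
forgetful functor are underlying morphisms of bimodule isomorphisms. -/

lemma underlyingIso_counit (f : dualComonR K A ≅ dualComonL K A) :
    (underlyingIso f).hom ≫ counitL K A = counitR K A :=
  IsComonHom.hom_counit f.hom.hom

lemma counitR_eq (K : C) (A : Mon C) :
    counitR K A = (ρ_ _).inv ≫ DR K A.X ◁ η[A.X] ≫ evR K A.X := by
  rw [← DRmap_evR, ← rightUnitor_inv_naturality_assoc]
  rfl

/-- `counitR` is evaluation at 1, and (φa)(1) = φ(a1) = φ(a). -/
lemma actR_counitR (K : C) (A : Mon C) : actR K A ≫ counitR K A = evR K A.X := by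
  rw [counitR_eq, rightUnitor_inv_naturality_assoc, ← whisker_exchange_assoc, actR_evR,
    associator_naturality_right_assoc, ← MonoidalCategory.whiskerLeft_comp_assoc,
    MonObj.mul_one]
  monoidal

/-- The pairing `A ⊗ D A ⟶ K` obtained from the evaluation of `D' A` along `f : D A ≅ D' A`. -/
def twistedEv (f : dualComonR K A ≅ dualComonL K A) : A.X ⊗ DR K A.X ⟶ K :=
  A.X ◁ (underlyingIso f).hom ≫ evL K A.X

/-- Transposition `Hom(A ⊗ Y, K) → Hom(Y, D A)` along `twistedEv`. -/
def curryTwisted (f : dualComonR K A ≅ dualComonL K A) {Y : C} (g : A.X ⊗ Y ⟶ K) :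
    Y ⟶ DR K A.X :=
  curryL g ≫ (underlyingIso f).inv

variable (f : dualComonR K A ≅ dualComonL K A)

lemma curryTwisted_twistedEv {Y : C} (g : A.X ⊗ Y ⟶ K) :
    A.X ◁ curryTwisted f g ≫ twistedEv f = g := by
  simp [curryTwisted, twistedEv, curryL_evL]

/-- Nondegeneracy in the `D A` variable, since `f` is invertible and `evL` is universal. -/
lemma twistedEv_ext {Y : C} {g h : Y ⟶ DR K A.X}
    (w : A.X ◁ g ≫ twistedEv f = A.X ◁ h ≫ twistedEv f) : g = h := by
  rw [← cancel_mono (underlyingIso f).hom]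
  apply DL_ext
  simpa [twistedEv] using w

lemma actLR_twistedEv : A.X ◁ actLR (underlyingIso f) ≫ twistedEv f =
    (α_ _ _ _).inv ≫ μ[A.X] ▷ _ ≫ twistedEv f := by
  rw [twistedEv, ← MonoidalCategory.whiskerLeft_comp_assoc, actLR, Category.assoc,
    Category.assoc, Iso.inv_hom_id, Category.comp_id, MonoidalCategory.whiskerLeft_comp,
    Category.assoc, actL_evL, ← whisker_exchange_assoc]
  simp

/-- In elements, (aφ)(b) = tw(a, φb). This is how the comultiplicativity of `f` enters the arguments
below; it exchanges the two pairings. -/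
lemma actLR_evR : actLR (underlyingIso f) ▷ A.X ≫ evR K A.X =
    (α_ _ _ _).hom ≫ A.X ◁ actR K A ≫ twistedEv f := by
  rw [twistedEv, ← MonoidalCategory.whiskerLeft_comp_assoc]
  exact key _ (underlyingIso_comul f)

/-- The counitality of `f` enters here: both pairings with the unit of `A` give the same form on `D
A`. -/
lemma one_twistedEv : η[A.X] ▷ _ ≫ twistedEv f = (λ_ _).hom ≫ counitR K A := by
  rw [twistedEv, ← whisker_exchange_assoc, ← underlyingIso_counit f, counitL_eq,
    leftUnitor_inv_naturality_assoc]
  simp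

/-- Replace the counit by tw(1, -) and use tw(1, aφ) = tw(1a, φ). -/
lemma actLR_counitR : actLR (underlyingIso f) ≫ counitR K A = twistedEv f := by
  have h := one_twistedEv f
  rw [← cancel_epi (λ_ _).hom, ← leftUnitor_naturality_assoc, ← h, whisker_exchange_assoc,
    actLR_twistedEv, associator_inv_naturality_left_assoc, ← comp_whiskerRight_assoc,
    MonObj.one_mul]
  simp

lemma actR_twistedEv : A.X ◁ actR K A ≫ twistedEv f =
    (α_ _ _ _).inv ≫ actLR (underlyingIso f) ▷ A.X ≫ evR K A.X := by
  rw [actLR_evR, Iso.inv_hom_id_assoc]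

end TwistedEvaluation

/-! ### The bimodule `D N` and its pairing with N -/

section BimoduleDual

open MonObj

variable {C : Type u} [Category.{v} C] [MonoidalCategory C] [MonoidalClosed C] [RightClosed C]
variable {K : C} {A : Mon C}

/-- The pairing `D N ⊗ N ⟶ D A` of a right `A`-module `N`: the transpose of
`D N ⊗ N ⊗ A ⟶ D N ⊗ N ⟶ K`. -/
def pairR (K : C) (N : Bimod A A) : DR K N.X ⊗ N.X ⟶ DR K A.X :=
  curryR ((α_ _ _ _).hom ≫ DR K N.X ◁ N.actRight ≫ evR K N.X)

lemma pairR_evR (N : Bimod A A) : pairR K N ▷ A.X ≫ evR K A.X =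
    (α_ _ _ _).hom ≫ DR K N.X ◁ N.actRight ≫ evR K N.X :=
  curryR_evR _

/-- Evaluation at 1 gives φ(n1) = φ(n), so the `D A`-valued pairing refines the ordinary evaluation.
-/
lemma pairR_counitR (N : Bimod A A) : pairR K N ≫ counitR K A = evR K N.X := by
  rw [counitR_eq, rightUnitor_inv_naturality_assoc, ← whisker_exchange_assoc, pairR_evR,
    associator_naturality_right_assoc, ← MonoidalCategory.whiskerLeft_comp_assoc,
    N.actRight_one]
  monoidal

/-- Evaluated at b, both sides are φ(n(ab)) = φ((na)b). -/
lemma actRight_pairR (N : Bimod A A) : DR K N.X ◁ N.actRight ≫ pairR K N =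
    (α_ _ _ _).inv ≫ pairR K N ▷ A.X ≫ actR K A := by
  apply DR_ext
  simp only [comp_whiskerRight, Category.assoc]
  rw [pairR_evR, actR_evR, associator_naturality_left_assoc, ← whisker_exchange_assoc, pairR_evR,
    associator_naturality_middle_assoc, ← MonoidalCategory.whiskerLeft_comp_assoc,
    associator_naturality_right_assoc, ← MonoidalCategory.whiskerLeft_comp_assoc,
    N.right_assoc]
  simp

/-- The right `A`-action on `D N` induced by the left `A`-action on `N`. -/
def dualActRight (K : C) (N : Bimod A A) : DR K N.X ⊗ A.X ⟶ DR K N.X :=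
  curryR ((α_ _ _ _).hom ≫ DR K N.X ◁ N.actLeft ≫ evR K N.X)

lemma dualActRight_evR (N : Bimod A A) : dualActRight K N ▷ N.X ≫ evR K N.X =
    (α_ _ _ _).hom ≫ DR K N.X ◁ N.actLeft ≫ evR K N.X :=
  curryR_evR _

/-- The pairing is balanced over `A` because the two actions on N commute: φ(a(nb)) = φ((an)b). -/
lemma dualActRight_pairR (N : Bimod A A) : dualActRight K N ▷ N.X ≫ pairR K N =
    (α_ _ _ _).hom ≫ DR K N.X ◁ N.actLeft ≫ pairR K N := by
  apply DR_ext
  simp only [comp_whiskerRight, Category.assoc]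
  rw [pairR_evR, associator_naturality_left_assoc, ← whisker_exchange_assoc, dualActRight_evR,
    associator_naturality_middle_assoc, ← MonoidalCategory.whiskerLeft_comp_assoc,
    N.middle_assoc]
  monoidal

variable [IsDualizing K] (f : dualComonR K A ≅ dualComonL K A)

/-- The left `A`-action on `D N` induced by the right `A`-action on `N` and `f : D A ≅ D' A`. -/
def dualActLeft (N : Bimod A A) : A.X ⊗ DR K N.X ⟶ DR K N.X :=
  curryR ((α_ _ _ _).hom ≫ A.X ◁ pairR K N ≫ twistedEv f)

lemma dualActLeft_evR (N : Bimod A A) : dualActLeft f N ▷ N.X ≫ evR K N.X =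
    (α_ _ _ _).hom ≫ A.X ◁ pairR K N ≫ twistedEv f :=
  curryR_evR _

/-- Left linearity by exchanging pairings: evaluated at b, (aφ)(nb) = tw(a, pair(φ, nb)) = tw(a,
pair(φ, n)b), which is (a pair(φ, n))(b) by `actLR_evR`. -/
lemma dualActLeft_pairR (N : Bimod A A) : dualActLeft f N ▷ N.X ≫ pairR K N =
    (α_ _ _ _).hom ≫ A.X ◁ pairR K N ≫ actLR (underlyingIso f) := by
  apply DR_ext
  simp only [comp_whiskerRight, Category.assoc]
  rw [pairR_evR, associator_naturality_left_assoc, ← whisker_exchange_assoc, dualActLeft_evR,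
    actLR_evR, associator_naturality_right_assoc, ← MonoidalCategory.whiskerLeft_comp_assoc,
    actRight_pairR]
  monoidal

/-- The `A`-bimodule `D N`. -/
def dualBimodR (N : Bimod A A) : Bimod A A where
  X := DR K N.X
  actLeft := dualActLeft f N
  -- (1φ)(n) = tw(1, pair(φ, n)) is the counit of pair(φ, n), that is φ(n).
  one_actLeft := by
    apply DR_ext
    rw [comp_whiskerRight, Category.assoc, dualActLeft_evR, associator_naturality_left_assoc,
      ← whisker_exchange_assoc, one_twistedEv, leftUnitor_naturality_assoc, pairR_counitR]
    monoidal
  -- By left linearity of the pairing, tw(a, pair(bφ, n)) = tw(a, b pair(φ, n)) = tw(ab, pair(φ,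
  -- n)).
  left_assoc := by
    apply DR_ext
    simp only [comp_whiskerRight, Category.assoc]
    rw [dualActLeft_evR, associator_naturality_left_assoc, ← whisker_exchange_assoc,
      associator_naturality_middle_assoc, ← MonoidalCategory.whiskerLeft_comp_assoc,
      dualActLeft_pairR]
    simp only [MonoidalCategory.whiskerLeft_comp, Category.assoc]
    rw [actLR_twistedEv]
    monoidal
  actRight := dualActRight K N
  actRight_one := by
    apply DR_ext
    rw [comp_whiskerRight, Category.assoc, dualActRight_evR, associator_naturality_middle_assoc,
      ← MonoidalCategory.whiskerLeft_comp_assoc, N.one_actLeft]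
    monoidal
  right_assoc := by
    apply DR_ext
    simp only [comp_whiskerRight, Category.assoc]
    rw [dualActRight_evR, associator_naturality_middle_assoc,
      ← MonoidalCategory.whiskerLeft_comp_assoc, associator_naturality_left_assoc,
      ← whisker_exchange_assoc, dualActRight_evR, N.left_assoc]
    monoidal
  -- The actions commute because the pairing is balanced: pair(φb, n) = pair(φ, bn).
  middle_assoc := by
    apply DR_ext
    simp only [comp_whiskerRight, Category.assoc]
    rw [dualActRight_evR, associator_naturality_left_assoc, ← whisker_exchange_assoc,
      dualActLeft_evR, associator_naturality_right_assoc, associator_naturality_middle_assoc,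
      ← MonoidalCategory.whiskerLeft_comp_assoc, ← MonoidalCategory.whiskerLeft_comp_assoc,
      dualActRight_pairR]
    monoidal

end BimoduleDual

/-! ### Morphisms out of M ⊗_A N as balanced bilinear morphisms -/

section RelativeTensor

open Limits

variable {C : Type u} [Category.{v} C] [MonoidalCategory C] [MonoidalClosed C] [RightClosed C]
variable [HasCoequalizers C] {A : Mon C}

/-- The projection `M ⊗ N ⟶ M ⊗_A N`. -/
noncomputable def proj (M N : Bimod A A) : M.X ⊗ N.X ⟶ (M ⊗ N : Bimod A A).X :=
  coequalizer.π (M.actRight ▷ N.X) ((α_ _ _ _).hom ≫ M.X ◁ N.actLeft)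

instance epi_proj (M N : Bimod A A) : Epi (proj M N) :=
  inferInstanceAs (Epi (coequalizer.π _ _))

/-- Tensoring with an object is a left adjoint, so it preserves the coequalizer projection as an
epimorphism. This lets linearity be checked before passing to the quotient. -/
instance epi_whiskerLeft_proj (X : C) (M N : Bimod A A) : Epi (X ◁ proj M N) :=
  inferInstanceAs (Epi ((tensorLeft X).map (coequalizer.π _ _)))

instance epi_proj_whiskerRight (X : C) (M N : Bimod A A) : Epi (proj M N ▷ X) :=
  inferInstanceAs (Epi ((tensorRight X).map (coequalizer.π _ _)))

lemma proj_balanced (M N : Bimod A A) :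
    M.actRight ▷ N.X ≫ proj M N = (α_ _ _ _).hom ≫ M.X ◁ N.actLeft ≫ proj M N :=
  (coequalizer.condition _ _).trans (Category.assoc _ _ _)

lemma proj_actLeft (M N : Bimod A A) : A.X ◁ proj M N ≫ (M ⊗ N : Bimod A A).actLeft =
    (α_ _ _ _).inv ≫ M.actLeft ▷ N.X ≫ proj M N :=
  Bimod.TensorBimod.whiskerLeft_π_actLeft M N

lemma proj_actRight (M N : Bimod A A) : proj M N ▷ A.X ≫ (M ⊗ N : Bimod A A).actRight =
    (α_ _ _ _).hom ≫ M.X ◁ N.actRight ≫ proj M N :=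
  Bimod.TensorBimod.π_tensor_id_actRight M N

lemma proj_whiskerLeft (M : Bimod A A) {N N' : Bimod A A} (g : N ⟶ N') :
    proj M N ≫ (M ◁ g).hom = M.X ◁ g.hom ≫ proj M N' :=
  ι_colimMap _ _

lemma proj_whiskerRight {M M' : Bimod A A} (g : M ⟶ M') (N : Bimod A A) :
    proj M N ≫ (g ▷ N).hom = g.hom ▷ N.X ≫ proj M' N :=
  ι_colimMap _ _

/-- The morphism `M ⊗_A N ⟶ X` induced by a balanced `M ⊗ N ⟶ X`. -/
noncomputable def desc {M N : Bimod A A} {X : C} (g : M.X ⊗ N.X ⟶ X)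
    (balanced : M.actRight ▷ N.X ≫ g = (α_ _ _ _).hom ≫ M.X ◁ N.actLeft ≫ g) :
    (M ⊗ N : Bimod A A).X ⟶ X :=
  coequalizer.desc g (balanced.trans (Category.assoc _ _ _).symm)

lemma proj_desc {M N : Bimod A A} {X : C} (g : M.X ⊗ N.X ⟶ X)
    (balanced : M.actRight ▷ N.X ≫ g = (α_ _ _ _).hom ≫ M.X ◁ N.actLeft ≫ g) :
    proj M N ≫ desc g balanced = g :=
  coequalizer.π_desc _ _

/-- The bimodule morphism `M ⊗_A N ⟶ P` induced by a balanced bilinear `M ⊗ N ⟶ P`. -/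
noncomputable def descHom {M N P : Bimod A A} (g : M.X ⊗ N.X ⟶ P.X)
    (balanced : M.actRight ▷ N.X ≫ g = (α_ _ _ _).hom ≫ M.X ◁ N.actLeft ≫ g)
    (left : M.actLeft ▷ N.X ≫ g = (α_ _ _ _).hom ≫ A.X ◁ g ≫ P.actLeft)
    (right : M.X ◁ N.actRight ≫ g = (α_ _ _ _).inv ≫ g ▷ A.X ≫ P.actRight) :
    (M ⊗ N : Bimod A A) ⟶ P where
  hom := desc g balanced
  left_act_hom := by
    have := congrArg (· ≫ desc g balanced) (proj_actLeft M N)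
    simp only [Category.assoc, proj_desc] at this
    rw [← cancel_epi (A.X ◁ proj M N), this, left, Iso.inv_hom_id_assoc,
      ← MonoidalCategory.whiskerLeft_comp_assoc, proj_desc]
  right_act_hom := by
    have := congrArg (· ≫ desc g balanced) (proj_actRight M N)
    simp only [Category.assoc, proj_desc] at this
    rw [← cancel_epi (proj M N ▷ A.X), this, right, Iso.hom_inv_id_assoc,
      ← comp_whiskerRight_assoc, proj_desc]

lemma proj_descHom {M N P : Bimod A A} (g : M.X ⊗ N.X ⟶ P.X)
    (balanced : M.actRight ▷ N.X ≫ g = (α_ _ _ _).hom ≫ M.X ◁ N.actLeft ≫ g)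
    (left : M.actLeft ▷ N.X ≫ g = (α_ _ _ _).hom ≫ A.X ◁ g ≫ P.actLeft)
    (right : M.X ◁ N.actRight ≫ g = (α_ _ _ _).inv ≫ g ▷ A.X ≫ P.actRight) :
    proj M N ≫ (descHom g balanced left right).hom = g :=
  proj_desc g balanced

lemma tensor_hom_ext {M N P : Bimod A A} {g h : (M ⊗ N : Bimod A A) ⟶ P}
    (w : proj M N ≫ g.hom = proj M N ≫ h.hom) : g = h :=
  Bimod.hom_ext _ _ ((cancel_epi (proj M N)).1 w)

variable {M N P : Bimod A A} (h : (M ⊗ N : Bimod A A) ⟶ P)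

/-- The bilinear morphism `M ⊗ N ⟶ P` underlying a bimodule morphism `M ⊗_A N ⟶ P`. -/
noncomputable def bilin : M.X ⊗ N.X ⟶ P.X := proj M N ≫ h.hom

lemma bilin_balanced : M.actRight ▷ N.X ≫ bilin h =
    (α_ _ _ _).hom ≫ M.X ◁ N.actLeft ≫ bilin h := by
  have := congrArg (· ≫ h.hom) (proj_balanced M N)
  simpa [bilin] using this

lemma actLeft_bilin : M.actLeft ▷ N.X ≫ bilin h =
    (α_ _ _ _).hom ≫ A.X ◁ bilin h ≫ P.actLeft := by
  have := congrArg (· ≫ h.hom) (proj_actLeft M N)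
  simp only [Category.assoc, h.left_act_hom] at this
  rw [bilin, MonoidalCategory.whiskerLeft_comp, Category.assoc, this, Iso.hom_inv_id_assoc]

lemma actRight_bilin : M.X ◁ N.actRight ≫ bilin h =
    (α_ _ _ _).inv ≫ bilin h ▷ A.X ≫ P.actRight := by
  have := congrArg (· ≫ h.hom) (proj_actRight M N)
  simp only [Category.assoc, h.right_act_hom] at this
  rw [bilin, comp_whiskerRight, Category.assoc, this, Iso.inv_hom_id_assoc]

lemma bilin_whiskerRight {M M' N P : Bimod A A} (g : M ⟶ M') (h : (M' ⊗ N : Bimod A A) ⟶ P) :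
    bilin (g ▷ N ≫ h) = g.hom ▷ N.X ≫ bilin h := by
  have := congrArg (· ≫ h.hom) (proj_whiskerRight g N)
  simpa [bilin] using this

lemma bilin_whiskerLeft {M N N' P : Bimod A A} (g : N ⟶ N') (h : (M ⊗ N' : Bimod A A) ⟶ P) :
    bilin (M ◁ g ≫ h) = M.X ◁ g.hom ≫ bilin h := by
  have := congrArg (· ≫ h.hom) (proj_whiskerLeft M g)
  simpa [bilin] using this

lemma bilin_injective {M N P : Bimod A A} {g h : (M ⊗ N : Bimod A A) ⟶ P}
    (w : bilin g = bilin h) : g = h :=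
  tensor_hom_ext w

end RelativeTensor

/-! ### `D N` represents Hom(- ⊗_A N, D A) -/

section Representability

open Limits

variable {C : Type u} [Category.{v} C] [MonoidalCategory C] [MonoidalClosed C] [RightClosed C]
variable [HasCoequalizers C] {A : Mon C} {K : C} [IsDualizing K]
variable (f : dualComonR K A ≅ dualComonL K A)

/-- The bilinear morphism `M ⊗ N ⟶ D A` underlying a bimodule morphism `M ⊗_A N ⟶ D A`. -/
noncomputable def dualBilin {M N : Bimod A A} (h : (M ⊗ N : Bimod A A) ⟶ dualBimod f) :
    M.X ⊗ N.X ⟶ DR K A.X :=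
  bilin h

lemma actRight_dualBilin {M N : Bimod A A} (h : (M ⊗ N : Bimod A A) ⟶ dualBimod f) :
    M.X ◁ N.actRight ≫ dualBilin f h = (α_ _ _ _).inv ≫ dualBilin f h ▷ A.X ≫ actR K A :=
  actRight_bilin h

lemma actLeft_dualBilin {M N : Bimod A A} (h : (M ⊗ N : Bimod A A) ⟶ dualBimod f) :
    M.actLeft ▷ N.X ≫ dualBilin f h =
      (α_ _ _ _).hom ≫ A.X ◁ dualBilin f h ≫ actLR (underlyingIso f) :=
  actLeft_bilin h

lemma dualBilin_balanced {M N : Bimod A A} (h : (M ⊗ N : Bimod A A) ⟶ dualBimod f) :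
    M.actRight ▷ N.X ≫ dualBilin f h = (α_ _ _ _).hom ≫ M.X ◁ N.actLeft ≫ dualBilin f h :=
  bilin_balanced h

lemma dualBilin_whiskerRight {M M' N : Bimod A A} (g : M ⟶ M')
    (h : (M' ⊗ N : Bimod A A) ⟶ dualBimod f) :
    dualBilin f (g ▷ N ≫ h) = g.hom ▷ N.X ≫ dualBilin f h :=
  bilin_whiskerRight g h

lemma dualBilin_whiskerLeft {M N N' : Bimod A A} (g : N ⟶ N')
    (h : (M ⊗ N' : Bimod A A) ⟶ dualBimod f) :
    dualBilin f (M ◁ g ≫ h) = M.X ◁ g.hom ≫ dualBilin f h :=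
  bilin_whiskerLeft g h

/-- The morphism underlying a bimodule morphism `M ⟶ D N`. -/
def toDual {M N : Bimod A A} (m : M ⟶ dualBimodR f N) : M.X ⟶ DR K N.X := m.hom

lemma toDual_ext {M N : Bimod A A} {m m' : M ⟶ dualBimodR f N}
    (w : toDual f m ▷ N.X ≫ evR K N.X = toDual f m' ▷ N.X ≫ evR K N.X) : m = m' :=
  Bimod.hom_ext _ _ (DR_ext w)

/-- A right linear h is recovered from its counit: evaluated at a, the left side is the counit of
h(m, na) = h(m, n)a, which is h(m, n)(a) by `actR_counitR`. Hence passing to K-valued functionals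
loses nothing. -/
lemma curryR_dualBilin_pairR {M N : Bimod A A} (h : (M ⊗ N : Bimod A A) ⟶ dualBimod f) :
    (curryR (dualBilin f h ≫ counitR K A) : M.X ⟶ DR K N.X) ▷ N.X ≫ pairR K N =
      dualBilin f h := by
  have hr := congrArg (· ≫ counitR K A) (actRight_dualBilin f h)
  simp only [Category.assoc] at hr
  apply DR_ext
  rw [comp_whiskerRight, Category.assoc, pairR_evR, associator_naturality_left_assoc,
    ← whisker_exchange_assoc, curryR_evR, hr, actR_counitR, Iso.hom_inv_id_assoc]

/-- The bimodule morphism `M ⟶ D N` corresponding to `M ⊗_A N ⟶ D A`. -/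
noncomputable def curryBimod {M N : Bimod A A} (h : (M ⊗ N : Bimod A A) ⟶ dualBimod f) :
    M ⟶ dualBimodR f N where
  hom := curryR (dualBilin f h ≫ counitR K A)
  left_act_hom := by
    change _ ≫ curryR (dualBilin f h ≫ counitR K A) = _ ◁ curryR _ ≫ dualActLeft f N
    -- The counit of h(am, n) = a h(m, n) is tw(a, h(m, n)) by `actLR_counitR`, which is the formula
    -- defining the left action on `D N`.
    have hl := congrArg (· ≫ counitR K A) (actLeft_dualBilin f h)
    simp only [Category.assoc] at hl
    apply DR_ext
    rw [comp_whiskerRight, Category.assoc, curryR_evR, hl, comp_whiskerRight,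
      Category.assoc, dualActLeft_evR, associator_naturality_middle_assoc,
      ← MonoidalCategory.whiskerLeft_comp_assoc, curryR_dualBilin_pairR, actLR_counitR]
  right_act_hom := by
    change _ ≫ curryR (dualBilin f h ≫ counitR K A) = curryR _ ▷ _ ≫ dualActRight K N
    -- Balancedness of h becomes right linearity of its transpose.
    have hb := congrArg (· ≫ counitR K A) (dualBilin_balanced f h)
    simp only [Category.assoc] at hb
    apply DR_ext
    rw [comp_whiskerRight, comp_whiskerRight, Category.assoc, Category.assoc, curryR_evR,
      dualActRight_evR, associator_naturality_left_assoc, ← whisker_exchange_assoc, curryR_evR, hb]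

/-- The bimodule evaluation `D N ⊗_A N ⟶ D A`. -/
noncomputable def evBimod (N : Bimod A A) :
    (dualBimodR f N ⊗ N : Bimod A A) ⟶ dualBimod f :=
  descHom (pairR K N) (dualActRight_pairR N) (dualActLeft_pairR f N) (actRight_pairR N)

lemma dualBilin_evBimod (N : Bimod A A) : dualBilin f (evBimod f N) = pairR K N := proj_descHom _ _ _ _

lemma toDual_curryBimod {M N : Bimod A A} (h : (M ⊗ N : Bimod A A) ⟶ dualBimod f) :
    toDual f (curryBimod f h) ▷ N.X ≫ evR K N.X = dualBilin f h ≫ counitR K A :=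
  curryR_evR _

/-- The bijection `Hom(M ⊗_A N, D A) ≃ Hom(M, D N)`. -/
noncomputable def curryBimodEquiv (M N : Bimod A A) :
    ((M ⊗ N : Bimod A A) ⟶ dualBimod f) ≃ (M ⟶ dualBimodR f N) where
  toFun h := curryBimod f h
  invFun m := m ▷ N ≫ evBimod f N
  left_inv h := bilin_injective (by
    change dualBilin f (curryBimod f h ▷ N ≫ evBimod f N) = _
    rw [dualBilin_whiskerRight, dualBilin_evBimod]
    exact curryR_dualBilin_pairR f h)
  right_inv m := toDual_ext f (by
    rw [toDual_curryBimod, dualBilin_whiskerRight, dualBilin_evBimod]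
    refine (Category.assoc _ _ _).trans ?_
    exact congrArg (m.hom ▷ N.X ≫ ·) (pairR_counitR N))

/-- The action of `D` on bimodule morphisms. -/
def dualBimodRMap {N N' : Bimod A A} (g : N ⟶ N') : dualBimodR f N' ⟶ dualBimodR f N :=
  -- Right linearity of g makes D g compatible with the `D A`-valued pairings; left linearity of D g
  -- then follows, since the left action is defined through them.
  have hp : DRmap K g.hom ▷ N.X ≫ pairR K N = DR K N'.X ◁ g.hom ≫ pairR K N' := by
    apply DR_ext
    simp only [comp_whiskerRight, Category.assoc]
    rw [pairR_evR, pairR_evR, associator_naturality_left_assoc, ← whisker_exchange_assoc,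
      DRmap_evR, associator_naturality_middle_assoc, ← MonoidalCategory.whiskerLeft_comp_assoc,
      ← MonoidalCategory.whiskerLeft_comp_assoc, g.right_act_hom]
  { hom := DRmap K g.hom
    left_act_hom := by
      change dualActLeft f N' ≫ DRmap K g.hom = A.X ◁ DRmap K g.hom ≫ dualActLeft f N
      apply DR_ext
      rw [comp_whiskerRight, comp_whiskerRight, Category.assoc, Category.assoc, dualActLeft_evR,
        DRmap_evR, ← whisker_exchange_assoc, dualActLeft_evR,
        associator_naturality_middle_assoc, associator_naturality_right_assoc,
        ← MonoidalCategory.whiskerLeft_comp_assoc, ← MonoidalCategory.whiskerLeft_comp_assoc, hp]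
    right_act_hom := by
      change dualActRight K N' ≫ DRmap K g.hom = DRmap K g.hom ▷ A.X ≫ dualActRight K N
      apply DR_ext
      rw [comp_whiskerRight, comp_whiskerRight, Category.assoc, Category.assoc, dualActRight_evR,
        DRmap_evR, ← whisker_exchange_assoc, dualActRight_evR,
        associator_naturality_left_assoc, ← whisker_exchange_assoc, DRmap_evR,
        associator_naturality_right_assoc, ← MonoidalCategory.whiskerLeft_comp_assoc,
        ← MonoidalCategory.whiskerLeft_comp_assoc, g.left_act_hom] }

/-- The duality functor `D` on `A`-bimodules. -/
def dualBimodFunctor : (Bimod A A)ᵒᵖ ⥤ Bimod A A where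
  obj N := dualBimodR f N.unop
  map g := dualBimodRMap f g.unop
  map_id N := Bimod.hom_ext _ _ ((dualR K).map_id (op N.unop.X))
  map_comp g h := Bimod.hom_ext _ _ ((dualR K).map_comp g.unop.hom.op h.unop.hom.op)

/-- The duality functor of `A`-bimodules associated to `D A`. -/
noncomputable def bimodDualityFunctor : DualityFunctor (dualBimod f) where
  D := dualBimodFunctor f
  homEquiv := curryBimodEquiv f
  homEquiv_naturality_left N g h := toDual_ext f (by
    change toDual f (curryBimod f _) ▷ N.X ≫ evR K N.X =
      (g.hom ≫ toDual f (curryBimod f h)) ▷ N.X ≫ evR K N.X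
    rw [comp_whiskerRight, Category.assoc, toDual_curryBimod, toDual_curryBimod,
      dualBilin_whiskerRight, Category.assoc])
  homEquiv_naturality_right M {N N'} g h := toDual_ext f (by
    change toDual f (curryBimod f _) ▷ N'.X ≫ evR K N'.X =
      (toDual f (curryBimod f h) ≫ DRmap K g.hom) ▷ N'.X ≫ evR K N'.X
    rw [comp_whiskerRight, Category.assoc, DRmap_evR, ← whisker_exchange_assoc,
      toDual_curryBimod, toDual_curryBimod, dualBilin_whiskerLeft, Category.assoc])

end Representability

/-! ### Full faithfulness of the duality on bimodules -/

section BimoduleDualFullyFaithful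

open Limits

variable {C : Type u} [Category.{v} C] [MonoidalCategory C] [MonoidalClosed C] [RightClosed C]
variable {A : Mon C} {K : C} [IsDualizing K]

/-- Nondegeneracy of evaluation in its second variable: d is invertible because K is dualizing. -/
lemma evR_ext {X Y : C} {g h : X ⟶ Y} (w : DR K Y ◁ g ≫ evR K Y = DR K Y ◁ h ≫ evR K Y) :
    g = h := by
  rw [← cancel_mono (dd K Y)]
  apply DL_ext
  rw [MonoidalCategory.whiskerLeft_comp, MonoidalCategory.whiskerLeft_comp, Category.assoc,
    Category.assoc, dd_evL, w]

variable (f : dualComonR K A ≅ dualComonL K A)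

/-- Fullness of the dual in C produces g with D g = h underlying; it remains to test its linearity
against all functionals. -/
lemma exists_dualBimodRMap_eq {N N' : Bimod A A} (h : dualBimodR f N' ⟶ dualBimodR f N) :
    ∃ g : N ⟶ N', dualBimodRMap f g = h := by
  have := dualR_isEquivalence K
  obtain ⟨t, ht⟩ : ∃ t : DR K N'.X ⟶ DR K N.X, t = h.hom := ⟨_, rfl⟩
  obtain ⟨g, hg⟩ : ∃ g : N.X ⟶ N'.X, DRmap K g = t :=
    ⟨((dualR K).preimage t).unop, (dualR K).map_preimage t⟩
  have hl : dualActLeft f N' ≫ t = A.X ◁ t ≫ dualActLeft f N := ht ▸ h.left_act_hom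
  have hr : dualActRight K N' ≫ t = t ▷ A.X ≫ dualActRight K N := ht ▸ h.right_act_hom
  have he : t ▷ N.X ≫ evR K N.X = DR K N'.X ◁ g ≫ evR K N'.X := hg ▸ DRmap_evR K g
  -- Left linearity of t says tw(a, pair(tφ, n)) = tw(a, pair(φ, gn)); nondegeneracy of `twistedEv`
  -- removes a.
  have hp : t ▷ N.X ≫ pairR K N = DR K N'.X ◁ g ≫ pairR K N' := by
    apply twistedEv_ext f
    have e := congrArg (fun s => (α_ _ _ _).inv ≫ s ▷ N.X ≫ evR K N.X) hl
    rw [comp_whiskerRight, comp_whiskerRight, Category.assoc, Category.assoc, dualActLeft_evR,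
      he, ← whisker_exchange_assoc, dualActLeft_evR, associator_naturality_right_assoc,
      associator_naturality_middle_assoc, Iso.inv_hom_id_assoc, Iso.inv_hom_id_assoc] at e
    rw [MonoidalCategory.whiskerLeft_comp, MonoidalCategory.whiskerLeft_comp, Category.assoc,
      Category.assoc, e]
  refine ⟨{ hom := g, left_act_hom := ?_, right_act_hom := ?_ }, Bimod.hom_ext _ _ (hg.trans ht)⟩
  -- Right linearity of t gives φ(g(an)) = (tφ)(an) = (t(φa))(n) = φ(a g(n)).
  · apply evR_ext (K := K)
    have e := congrArg (fun s => (α_ _ _ _).inv ≫ s ▷ N.X ≫ evR K N.X) hr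
    rw [comp_whiskerRight, comp_whiskerRight, Category.assoc, Category.assoc, dualActRight_evR,
      he, ← whisker_exchange_assoc, dualActRight_evR, associator_naturality_right_assoc,
      associator_naturality_left_assoc, Iso.inv_hom_id_assoc, Iso.inv_hom_id_assoc,
      ← whisker_exchange_assoc, he] at e
    rw [MonoidalCategory.whiskerLeft_comp, MonoidalCategory.whiskerLeft_comp, Category.assoc,
      Category.assoc, e]
  -- Evaluating `hp` at a gives φ(g(na)) = φ(g(n)a).
  · apply evR_ext (K := K)
    have e := congrArg (fun s => (α_ _ _ _).inv ≫ s ▷ A.X ≫ evR K A.X) hp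
    rw [comp_whiskerRight, comp_whiskerRight, Category.assoc, Category.assoc, pairR_evR,
      pairR_evR, associator_naturality_middle_assoc, associator_naturality_left_assoc,
      Iso.inv_hom_id_assoc, Iso.inv_hom_id_assoc, ← whisker_exchange_assoc, he] at e
    rw [MonoidalCategory.whiskerLeft_comp, MonoidalCategory.whiskerLeft_comp, Category.assoc,
      Category.assoc, e]

instance dualBimodFunctor_full : (dualBimodFunctor f).Full where
  map_surjective h := by
    obtain ⟨g, hg⟩ := exists_dualBimodRMap_eq f h
    exact ⟨g.op, hg⟩

instance dualBimodFunctor_faithful : (dualBimodFunctor f).Faithful where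
  map_injective {N N' g h} w := by
    have := dualR_isEquivalence K
    have e : DRmap K g.unop.hom = DRmap K h.unop.hom := congrArg Bimod.Hom.hom w
    exact Quiver.Hom.unop_inj
      (Bimod.hom_ext _ _ (Quiver.Hom.op_inj ((dualR K).map_injective e)))

end BimoduleDualFullyFaithful

/-! ### The bimodule D'P and essential surjectivity -/

section BimoduleLeftDual

open MonObj

variable {C : Type u} [Category.{v} C] [MonoidalCategory C] [MonoidalClosed C] [RightClosed C]
variable {A : Mon C} {K : C} [IsDualizing K]
variable (f : dualComonR K A ≅ dualComonL K A)

/-- The pairing `P ⊗ D' P ⟶ D A` of a left `A`-module `P`: the transpose, along `f : D A ≅ D' A`,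
of `A ⊗ P ⊗ D' P ⟶ P ⊗ D' P ⟶ K`. -/
def pairL (P : Bimod A A) : P.X ⊗ DL K P.X ⟶ DR K A.X :=
  curryTwisted f ((α_ _ _ _).inv ≫ P.actLeft ▷ DL K P.X ≫ evL K P.X)

lemma pairL_twistedEv (P : Bimod A A) : A.X ◁ pairL f P ≫ twistedEv f =
    (α_ _ _ _).inv ≫ P.actLeft ▷ DL K P.X ≫ evL K P.X :=
  curryTwisted_twistedEv f _

/-- The counit is tw(1, -), and pairing 1 with `pairL` evaluates at 1p = p. -/
lemma pairL_counitR (P : Bimod A A) : pairL f P ≫ counitR K A = evL K P.X := by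
  rw [← cancel_epi (λ_ _).hom, ← leftUnitor_naturality_assoc, ← one_twistedEv f,
    whisker_exchange_assoc, pairL_twistedEv, associator_inv_naturality_left_assoc,
    ← comp_whiskerRight_assoc, P.one_actLeft]
  monoidal

lemma actLeft_pairL (P : Bimod A A) : P.actLeft ▷ DL K P.X ≫ pairL f P =
    (α_ _ _ _).hom ≫ A.X ◁ pairL f P ≫ actLR (underlyingIso f) := by
  apply twistedEv_ext f
  simp only [MonoidalCategory.whiskerLeft_comp, Category.assoc]
  rw [pairL_twistedEv, actLR_twistedEv, associator_inv_naturality_right_assoc,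
    whisker_exchange_assoc, pairL_twistedEv, associator_inv_naturality_middle_assoc,
    associator_inv_naturality_left_assoc, ← comp_whiskerRight_assoc (μ[A.X] ▷ _), P.left_assoc]
  monoidal

/-- The left `A`-action on `D' P` induced by the right `A`-action on `P`. -/
def leftDualActLeft (K : C) (P : Bimod A A) : A.X ⊗ DL K P.X ⟶ DL K P.X :=
  curryL ((α_ _ _ _).inv ≫ P.actRight ▷ DL K P.X ≫ evL K P.X)

lemma leftDualActLeft_evL (P : Bimod A A) : P.X ◁ leftDualActLeft K P ≫ evL K P.X =
    (α_ _ _ _).inv ≫ P.actRight ▷ DL K P.X ≫ evL K P.X :=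
  curryL_evL _

/-- Balancedness again comes from the commuting actions on P, tested here with `twistedEv`. -/
lemma leftDualActLeft_pairL (P : Bimod A A) : P.X ◁ leftDualActLeft K P ≫ pairL f P =
    (α_ _ _ _).inv ≫ P.actRight ▷ DL K P.X ≫ pairL f P := by
  apply twistedEv_ext f
  simp only [MonoidalCategory.whiskerLeft_comp, Category.assoc]
  rw [pairL_twistedEv, associator_inv_naturality_right_assoc,
    whisker_exchange_assoc, leftDualActLeft_evL, associator_inv_naturality_middle_assoc,
    associator_inv_naturality_left_assoc, ← comp_whiskerRight_assoc (P.actLeft ▷ _),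
    P.middle_assoc]
  monoidal

/-- The right `A`-action on `D' P` induced by the left `A`-action on `P` and `f : D A ≅ D' A`. -/
def leftDualActRight (P : Bimod A A) : DL K P.X ⊗ A.X ⟶ DL K P.X :=
  curryL ((α_ _ _ _).inv ≫ pairL f P ▷ A.X ≫ evR K A.X)

lemma leftDualActRight_evL (P : Bimod A A) : P.X ◁ leftDualActRight f P ≫ evL K P.X =
    (α_ _ _ _).inv ≫ pairL f P ▷ A.X ≫ evR K A.X :=
  curryL_evL _

/-- Mirror of `dualActLeft_pairR`: left linearity of `pairL` and the exchange of pairings in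
`actR_twistedEv` give right linearity. -/
lemma leftDualActRight_pairL (P : Bimod A A) : P.X ◁ leftDualActRight f P ≫ pairL f P =
    (α_ _ _ _).inv ≫ pairL f P ▷ A.X ≫ actR K A := by
  apply twistedEv_ext f
  simp only [MonoidalCategory.whiskerLeft_comp, Category.assoc]
  rw [pairL_twistedEv, associator_inv_naturality_right_assoc, whisker_exchange_assoc,
    leftDualActRight_evL, associator_inv_naturality_left_assoc, ← comp_whiskerRight_assoc,
    actLeft_pairL, actR_twistedEv, associator_inv_naturality_middle_assoc]
  monoidal

/-- The `A`-bimodule `D' P`. -/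
def dualBimodL (P : Bimod A A) : Bimod A A where
  X := DL K P.X
  actLeft := leftDualActLeft K P
  one_actLeft := by
    apply DL_ext
    rw [MonoidalCategory.whiskerLeft_comp, Category.assoc, leftDualActLeft_evL,
      associator_inv_naturality_middle_assoc, ← comp_whiskerRight_assoc, P.actRight_one]
    monoidal
  left_assoc := by
    apply DL_ext
    simp only [MonoidalCategory.whiskerLeft_comp, Category.assoc]
    rw [leftDualActLeft_evL, associator_inv_naturality_middle_assoc, ← comp_whiskerRight_assoc,
      associator_inv_naturality_right_assoc, whisker_exchange_assoc, leftDualActLeft_evL,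
      P.right_assoc, associator_inv_naturality_left_assoc]
    monoidal
  actRight := leftDualActRight f P
  -- Evaluation of `pairL` at 1 is its counit, hence the ordinary evaluation of D'P.
  actRight_one := by
    apply DL_ext
    rw [MonoidalCategory.whiskerLeft_comp, Category.assoc, leftDualActRight_evL,
      associator_inv_naturality_right_assoc, whisker_exchange_assoc, ← pairL_counitR f,
      counitR_eq, rightUnitor_inv_naturality_assoc]
    monoidal
  right_assoc := by
    apply DL_ext
    simp only [MonoidalCategory.whiskerLeft_comp, Category.assoc]
    rw [leftDualActRight_evL, associator_inv_naturality_right_assoc, whisker_exchange_assoc,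
      associator_inv_naturality_middle_assoc, ← comp_whiskerRight_assoc,
      leftDualActRight_pairL]
    simp only [comp_whiskerRight, Category.assoc]
    rw [actR_evR]
    monoidal
  middle_assoc := by
    apply DL_ext
    simp only [MonoidalCategory.whiskerLeft_comp, Category.assoc]
    rw [leftDualActRight_evL, leftDualActLeft_evL, associator_inv_naturality_middle_assoc,
      ← comp_whiskerRight_assoc, leftDualActLeft_pairL, associator_inv_naturality_right_assoc,
      whisker_exchange_assoc, leftDualActRight_evL, associator_inv_naturality_left_assoc]
    monoidal

/-- The pairing `D D' P ⊗ D' P ⟶ D A`. -/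
def bidualPair (P : Bimod A A) : DR K (DL K P.X) ⊗ DL K P.X ⟶ DR K A.X :=
  pairR K (dualBimodL f P)

/-- The left `A`-action on `D D' P`. -/
def bidualActLeft (P : Bimod A A) : A.X ⊗ DR K (DL K P.X) ⟶ DR K (DL K P.X) :=
  dualActLeft f (dualBimodL f P)

/-- The right `A`-action on `D D' P`. -/
def bidualActRight (P : Bimod A A) : DR K (DL K P.X) ⊗ A.X ⟶ DR K (DL K P.X) :=
  dualActRight K (dualBimodL f P)

lemma bidualPair_evR (P : Bimod A A) : bidualPair f P ▷ A.X ≫ evR K A.X =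
    (α_ _ _ _).hom ≫ _ ◁ leftDualActRight f P ≫ evR K (DL K P.X) :=
  pairR_evR (dualBimodL f P)

lemma bidualActLeft_evR (P : Bimod A A) : bidualActLeft f P ▷ DL K P.X ≫ evR K (DL K P.X) =
    (α_ _ _ _).hom ≫ A.X ◁ bidualPair f P ≫ twistedEv f :=
  dualActLeft_evR f (dualBimodL f P)

lemma bidualActRight_evR (P : Bimod A A) : bidualActRight f P ▷ DL K P.X ≫ evR K (DL K P.X) =
    (α_ _ _ _).hom ≫ _ ◁ leftDualActLeft K P ≫ evR K (DL K P.X) :=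
  dualActRight_evR (dualBimodL f P)

/-- Evaluated at a, both sides are the evaluation of ψa at p, for ψ in D'P. So the `D A`-valued
pairings of P and D D'P with D'P agree along d̃, which yields the left linearity of d̃. -/
lemma dd'_bidualPair (P : Bimod A A) : dd' K P.X ▷ DL K P.X ≫ bidualPair f P = pairL f P := by
  apply DR_ext
  rw [comp_whiskerRight, Category.assoc, bidualPair_evR, associator_naturality_left_assoc,
    ← whisker_exchange_assoc, dd'_evR, leftDualActRight_evL, Iso.hom_inv_id_assoc]

lemma actLeft_dd' (P : Bimod A A) :
    P.actLeft ≫ dd' K P.X = A.X ◁ dd' K P.X ≫ bidualActLeft f P := by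
  apply DR_ext
  rw [comp_whiskerRight, comp_whiskerRight, Category.assoc, Category.assoc, dd'_evR,
    bidualActLeft_evR, associator_naturality_middle_assoc,
    ← MonoidalCategory.whiskerLeft_comp_assoc, dd'_bidualPair, pairL_twistedEv,
    Iso.hom_inv_id_assoc]

/-- The right action on D D'P dualizes the left action on D'P, which itself dualizes the right
action on P; testing on D'P undoes both. -/
lemma actRight_dd' (P : Bimod A A) :
    P.actRight ≫ dd' K P.X = dd' K P.X ▷ A.X ≫ bidualActRight f P := by
  apply DR_ext
  rw [comp_whiskerRight, comp_whiskerRight, Category.assoc, Category.assoc, dd'_evR,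
    bidualActRight_evR, associator_naturality_left_assoc, ← whisker_exchange_assoc, dd'_evR,
    leftDualActLeft_evL, Iso.hom_inv_id_assoc]

/-- The bimodule isomorphism `P ≅ D D' P`. -/
noncomputable def bimodBidual (P : Bimod A A) : P ≅ dualBimodR f (dualBimodL f P) :=
  Bimod.isoOfIso (Q := dualBimodR f (dualBimodL f P)) (dd'Iso K P.X) (actLeft_dd' f P)
    (actRight_dd' f P)

instance dualBimodFunctor_essSurj : (dualBimodFunctor f).EssSurj where
  mem_essImage P := ⟨op (dualBimodL f P), ⟨(bimodBidual f P).symm⟩⟩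

instance dualBimodFunctor_isEquivalence : (dualBimodFunctor f).IsEquivalence where

end BimoduleLeftDual

/-! ### Duality transformations described by their pairings -/

section FormOnForget

variable {C : Type u} [Category.{v} C] [MonoidalCategory C]
variable {E : Type u₁} [Category.{v₁} E] [MonoidalCategory E]
variable (F : C ⥤ E) [F.LaxMonoidal] {K : C} {K' : E}

/-- By the universal property of the internal hom this equation determines `xiL`, so the
transformation can be identified without unfolding the closed structures. The right-handed version
is analogous. -/
lemma xiL_evL [MonoidalClosed C] [MonoidalClosed E] (υ : F.obj K ⟶ K') (X : C) :
    F.obj X ◁ xiL F υ X ≫ evL K' (F.obj X) =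
      Functor.LaxMonoidal.μ F X (DL K X) ≫ F.map (evL K X) ≫ υ := by
  have h : F.obj X ◁ (ihom (F.obj X)).map υ ≫ (ihom.ev (F.obj X)).app K' =
      (ihom.ev (F.obj X)).app (F.obj K) ≫ υ := ihom.ev_naturality _ _
  have h' : F.obj X ◁ tauL F X K ≫ (ihom.ev (F.obj X)).app (F.obj K) =
      Functor.LaxMonoidal.μ F X (DL K X) ≫ F.map (evL K X) := curry_ev _
  change F.obj X ◁ (tauL F X K ≫ (ihom (F.obj X)).map υ) ≫ (ihom.ev (F.obj X)).app K' = _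
  rw [MonoidalCategory.whiskerLeft_comp, Category.assoc, h, ← Category.assoc, h']
  exact Category.assoc _ _ _

lemma xiR_evR [RightClosed C] [RightClosed E] (υ : F.obj K ⟶ K') (X : C) :
    xiR F υ X ▷ F.obj X ≫ evR K' (F.obj X) =
      Functor.LaxMonoidal.μ F (DR K X) X ≫ F.map (evR K X) ≫ υ := by
  have h : tauR F X K ▷ F.obj X ≫ rev (F.obj X) (F.obj K) =
      Functor.LaxMonoidal.μ F (DR K X) X ≫ F.map (evR K X) := rcurry_rev _
  change (tauR F X K ≫ (RightClosed.rhom (F.obj X)).map υ) ▷ F.obj X ≫ rev (F.obj X) K' = _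
  rw [comp_whiskerRight, Category.assoc, rhom_map_rev, ← Category.assoc, h]
  exact Category.assoc _ _ _

end FormOnForget

/-! ### Internal homs of bimodules into `D A` and the Frobenius form -/

section BimoduleFrobenius

open Limits

variable {C : Type u} [Category.{v} C] [MonoidalCategory C] [MonoidalClosed C] [RightClosed C]
variable [HasCoequalizers C] {A : Mon C} {K : C} [IsDualizing K]
variable (f : dualComonR K A ≅ dualComonL K A)

lemma isDualizing_dualBimod : IsDualizing (dualBimod f) :=
  ⟨bimodDualityFunctor f, dualBimodFunctor_isEquivalence f⟩

lemma comp_curryBimod {M M' N : Bimod A A} (g : M ⟶ M')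
    (h : (M' ⊗ N : Bimod A A) ⟶ dualBimod f) :
    g ≫ curryBimod f h = curryBimod f (g ▷ N ≫ h) :=
  ((bimodDualityFunctor f).homEquiv_naturality_left N g h).symm

lemma curryBimod_whiskerRight_evBimod {M N : Bimod A A}
    (h : (M ⊗ N : Bimod A A) ⟶ dualBimod f) : curryBimod f h ▷ N ≫ evBimod f N = h :=
  (curryBimodEquiv f M N).symm_apply_apply h

lemma curryBimod_evBimod (N : Bimod A A) : curryBimod f (evBimod f N) = 𝟙 _ := by
  have h := (curryBimodEquiv f (dualBimodR f N) N).apply_symm_apply (𝟙 _)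
  change curryBimod f (𝟙 _ ▷ N ≫ evBimod f N) = 𝟙 _ at h
  rwa [id_whiskerRight, Category.id_comp] at h

/-- The isomorphism between the internal hom `D A ⟜ N` of bimodules and the bimodule `D N`. -/
noncomputable def rhomIsoDual [RightClosed (Bimod A A)] (N : Bimod A A) :
    DR (dualBimod f) N ≅ dualBimodR f N where
  hom := curryBimod f (evR (dualBimod f) N)
  inv := curryR (evBimod f N)
  hom_inv_id := DR_ext (by
    rw [comp_whiskerRight, Category.assoc, curryR_evR, curryBimod_whiskerRight_evBimod,
      id_whiskerRight, Category.id_comp])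
  inv_hom_id := by rw [comp_curryBimod, curryR_evR, curryBimod_evBimod]

/-- The bimodule evaluation `P ⊗_A D' P ⟶ D A`. -/
noncomputable def leftEvBimod (P : Bimod A A) :
    (P ⊗ dualBimodL f P : Bimod A A) ⟶ dualBimod f :=
  (bimodBidual f P).hom ▷ _ ≫ evBimod f (dualBimodL f P)

/-- The morphism underlying a bimodule morphism `M ⟶ D' P`. -/
def toLeftDual {M P : Bimod A A} (m : M ⟶ dualBimodL f P) : M.X ⟶ DL K P.X := m.hom

/-- The bilinear map under `leftEvBimod` is `pairL`, by `dd'_bidualPair`, and the counit turns it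
into the evaluation of C. -/
lemma dualBilin_leftEvBimod {M P : Bimod A A} (m : M ⟶ dualBimodL f P) :
    dualBilin f (P ◁ m ≫ leftEvBimod f P) ≫ counitR K A =
      P.X ◁ toLeftDual f m ≫ evL K P.X := by
  have e : dualBilin f (leftEvBimod f P) = pairL f P := by
    rw [leftEvBimod, dualBilin_whiskerRight, dualBilin_evBimod]
    exact dd'_bidualPair f P
  rw [dualBilin_whiskerLeft, e]
  refine (Category.assoc _ _ _).trans ?_
  exact congrArg (P.X ◁ m.hom ≫ ·) (pairL_counitR f P)

lemma leftEvBimod_ext {M P : Bimod A A} {m m' : M ⟶ dualBimodL f P}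
    (w : P ◁ m ≫ leftEvBimod f P = P ◁ m' ≫ leftEvBimod f P) : m = m' :=
  Bimod.hom_ext _ _ (DL_ext (by
    have h := congrArg (fun t => dualBilin f t ≫ counitR K A) w
    simp only [dualBilin_leftEvBimod] at h
    exact h))

/-- The left representability follows from the right one: h transposes to P ⟶ D M, precomposition
with P ≅ D D'P gives D D'P ⟶ D M, and fullness of the duality gives M ⟶ D'P. -/
lemma exists_whiskerLeft_leftEvBimod {M P : Bimod A A}
    (h : (P ⊗ M : Bimod A A) ⟶ dualBimod f) :
    ∃ m : M ⟶ dualBimodL f P, P ◁ m ≫ leftEvBimod f P = h := by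
  obtain ⟨m, hm⟩ := exists_dualBimodRMap_eq f ((bimodBidual f P).inv ≫ curryBimod f h)
  refine ⟨m, (curryBimodEquiv f P M).injective ?_⟩
  refine ((bimodDualityFunctor f).homEquiv_naturality_right P m _).trans ?_
  change curryBimod f (leftEvBimod f P) ≫ dualBimodRMap f m = curryBimod f h
  rw [hm, leftEvBimod, ← comp_curryBimod, curryBimod_evBimod, Category.comp_id,
    Iso.hom_inv_id_assoc]

/-- Uniqueness of representing objects: the internal hom and D'P carry universal pairings with P
into `D A`, so the comparison maps are mutually inverse. -/
lemma exists_ihomIsoDual [MonoidalClosed (Bimod A A)] (P : Bimod A A) :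
    ∃ m : DL (dualBimod f) P ⟶ dualBimodL f P, IsIso m ∧
      P ◁ m ≫ leftEvBimod f P = evL (dualBimod f) P := by
  obtain ⟨m, hm⟩ := exists_whiskerLeft_leftEvBimod f (evL (dualBimod f) P)
  refine ⟨m, ⟨curryL (leftEvBimod f P), DL_ext ?_, leftEvBimod_ext f ?_⟩, hm⟩
  · rw [MonoidalCategory.whiskerLeft_comp, Category.assoc, curryL_evL, hm,
      MonoidalCategory.whiskerLeft_id, Category.id_comp]
  · rw [MonoidalCategory.whiskerLeft_comp, Category.assoc, hm, curryL_evL,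
      MonoidalCategory.whiskerLeft_id, Category.id_comp]

/-- Any closed structure on bimodules may be chosen, since its internal homs into `D A` are compared
with the explicit duals by isomorphisms respecting evaluation. -/
lemma isFrobeniusForm_counitR [MonoidalClosed (Bimod A A)] [RightClosed (Bimod A A)] :
    IsFrobeniusForm (Bimod.forget A (B := A)) (K := dualBimod f) (K' := K) (counitR K A) where
  isIso_xiL P := by
    obtain ⟨m, hi, hm⟩ := exists_ihomIsoDual f P
    -- Both morphisms have the same pairing with P into K: the evaluation of bimodules followed by
    -- `counitR`.
    have h : xiL (Bimod.forget A (B := A)) (K := dualBimod f) (K' := K) (counitR K A) P =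
        toLeftDual f m := DL_ext (by
      refine (xiL_evL (Bimod.forget A (B := A)) (K := dualBimod f) (counitR K A) P).trans ?_
      refine Eq.trans ?_ (dualBilin_leftEvBimod f m)
      rw [hm]
      exact (Category.assoc _ _ _).symm)
    rw [h]
    exact inferInstanceAs (IsIso ((Bimod.forget A).map m))
  isIso_xiR N := by
    have h : xiR (Bimod.forget A (B := A)) (K := dualBimod f) (K' := K) (counitR K A) N =
        toDual f (rhomIsoDual f N).hom := DR_ext (by
      refine (xiR_evR (Bimod.forget A (B := A)) (K := dualBimod f) (counitR K A) N).trans ?_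
      refine Eq.trans ?_ (toDual_curryBimod f _).symm
      exact (Category.assoc _ _ _).symm)
    rw [h]
    exact inferInstanceAs (IsIso ((Bimod.forget A).map (rhomIsoDual f N).hom))

end BimoduleFrobenius

end GV

theorem mainTheorem6 {C : Type u} [Category.{v} C] [MonoidalCategory C]
    [MonoidalClosed C] [GV.RightClosed C] [Limits.HasEqualizers C] [Limits.HasCoequalizers C]
    (K : C) [GV.IsDualizing K] (A : Mon C) (f : GV.dualComonR K A ≅ GV.dualComonL K A) :
    GV.IsDualizing (GV.dualBimod f) ∧
    Nonempty (MonoidalClosed (Bimod A A)) ∧ Nonempty (GV.RightClosed (Bimod A A)) ∧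
    ∀ [MonoidalClosed (Bimod A A)] [GV.RightClosed (Bimod A A)],
      GV.IsFrobeniusForm (Bimod.forget A (B := A)) (K := GV.dualBimod f) (K' := K)
        (GV.counitR K A) := by
  have := GV.isDualizing_dualBimod f
  exact ⟨this, GV.IsDualizing.nonempty_monoidalClosed (GV.dualBimod f),
    GV.IsDualizing.nonempty_rightClosed (GV.dualBimod f), GV.isFrobeniusForm_counitR f⟩
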